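/- Let $Q$ be a quiver, i.e. a finite oriented graph with vertex set $I$ and edge set $E$, where loops and multiple edges are allowed. Let $\mathbb{F} = \mathbb{Q}(q, t_e)_{e \in E}$, where $q$ and the $t_e$ are independent variables. For $\boldsymbol{n} = (n_i)_{i \in I} \in \mathbb{N}^I$ (with $0 \in \mathbb{N}$), let $\mathcal{V}_{\boldsymbol{n}}$ be the $\mathbb{F}$-vector space of Laurent polynomials over $\mathbb{F}$ in the variables $z_{ia}$ ($i \in I$, $1 \leq a \leq n_i$) that are symmetric in $z_{i1}, \dots, z_{in_i}$ for each $i$ separately, and let $\mathcal{V} = \bigoplus_{\boldsymbol{n} \in \mathbb{N}^I} \mathcal{V}_{\boldsymbol{n}}$. For $i, j \in I$ put $$ \zeta_{ij}(x) = \left( \frac{1 - x q^{-1}}{1 - x} \right)^{\delta^i_j} \prod_{e = \overrightarrow{ij} \in E} (1 - t_e x) \prod_{e = \overrightarrow{ji} \in E} \left( 1 - \frac{q x}{t_e} \right). $$ The shuffle product of $R \in \mathcal{V}_{\boldsymbol{n}}$ and $R' \in \mathcal{V}_{\boldsymbol{n}'}$ is the element of $\mathcal{V}_{\boldsymbol{n}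 + \boldsymbol{n}'}$ $$ R * R' = \mathrm{Sym} \left[ \frac{R(\dots, z_{i1}, \dots, z_{in_i}, \dots) \, R'(\dots, z_{i,n_i+1}, \dots, z_{i,n_i+n'_i}, \dots)}{\prod_{i \in I} n_i! \prod_{i \in I} n'_i!} \prod_{i,j \in I} \ \prod_{1 \leq a \leq n_i} \ \prod_{n_j < b \leq n_j + n'_j} \zeta_{ij} \left( \frac{z_{ia}}{z_{jb}} \right) \right], $$ where $\mathrm{Sym}$ is the sum over all permutations of $z_{i1}, \dots, z_{i,n_i+n'_i}$ for each $i \in I$ separately; this makes $\mathcal{V}$ a unital $\mathbb{F}$-algebra, with unit $1 \in \mathcal{V}_{\boldsymbol{0}} = \mathbb{F}$. Let $\mathcal{S} = \bigoplus_{\boldsymbol{n}} \mathcal{S}_{\boldsymbol{n}} \subset \mathcal{V}$, the shuffle algebra, be given by those $R$ that satisfy the wheel conditions $$ R \Big|_{z_{ia} = \frac{q z_{jb}}{t_e} = q z_{ic}} = R \Big|_{z_{ja} = t_e z_{ib} = q z_{jc}} = 0 $$ for all edges $e = \overrightarrow{ij}$ and all $a \neq c$ (with $a, b, c$ pairwise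 distinct if $i = j$). For $i \in I$ let $\boldsymbol{\varsigma}_i \in \mathbb{N}^I$ be the vector with $1$ in position $i$ and $0$ elsewhere, so that $\mathcal{S}_{\boldsymbol{\varsigma}_i} = \mathbb{F}[z_{i1}^{\pm 1}]$. Let $\mathring{\mathcal{S}}$, the spherical subalgebra, be the (unital) subalgebra generated by $\mathcal{S}_{\boldsymbol{\varsigma}_i}$ for all $i \in I$. Theorem. $\mathring{\mathcal{S}} = \mathcal{S}$. -/

import Mathlib

open scoped DirectSum

namespace QuiverShuffle

noncomputable section

universe u v

section Parameters

variable (I : Type u) [Quiver.{v} I]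

/-- The set of all edges of the quiver with vertex set `I`. -/
abbrev Edges : Type (max u v) := Σ i j : I, (i ⟶ j)

/-- The ground field `ℚ(q, t_e)`: rational functions over `ℚ` in the variable `q` (the index `none`)
and one variable `t_e` for each edge `e` (the index `some e`). -/
def Ground : Type (max u v) := FractionRing (MvPolynomial (Option (Edges I)) ℚ)

instance : Field (Ground I) :=
  inferInstanceAs (Field (FractionRing (MvPolynomial (Option (Edges I)) ℚ)))

instance : Algebra (MvPolynomial (Option (Edges I)) ℚ) (Ground I) :=
  inferInstanceAs (Algebra (MvPolynomial (Option (Edges I)) ℚ)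
    (FractionRing (MvPolynomial (Option (Edges I)) ℚ)))

instance : IsFractionRing (MvPolynomial (Option (Edges I)) ℚ) (Ground I) :=
  inferInstanceAs (IsFractionRing (MvPolynomial (Option (Edges I)) ℚ)
    (FractionRing (MvPolynomial (Option (Edges I)) ℚ)))

/-- The parameter `q`. -/
def q : Ground I := algebraMap (MvPolynomial (Option (Edges I)) ℚ) _ (MvPolynomial.X none)

variable {I} in
/-- The parameter `t_e` of an edge `e` from `i` to `j`. -/
def t {i j : I} (e : i ⟶ j) : Ground I :=
  algebraMap (MvPolynomial (Option (Edges I)) ℚ) _ (MvPolynomial.X (some ⟨i, j, e⟩))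

end Parameters

section Functions

variable {I : Type u} [Quiver.{v} I]

/-- The index set of the variables `z_{ia}`, `1 ≤ a ≤ n_i`, in degree `n`. -/
abbrev Var (n : I → ℕ) : Type u := Σ i : I, Fin (n i)

/-- Laurent polynomials over the ground field in the variables `z_{ia}`: the monomial
`∏ z_{ia} ^ (d (i, a))` is `single d 1`. -/
abbrev Laurent (n : I → ℕ) : Type (max u v) := AddMonoidAlgebra (Ground I) (Var n → ℤ)

/-- Rational functions over the ground field in the variables `z_{ia}`. -/
def RatFun (n : I → ℕ) : Type (max u v) := FractionRing (MvPolynomial (Var n) (Ground I))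

instance (n : I → ℕ) : Field (RatFun n) :=
  inferInstanceAs (Field (FractionRing (MvPolynomial (Var n) (Ground I))))

instance (n : I → ℕ) : Algebra (MvPolynomial (Var n) (Ground I)) (RatFun n) :=
  inferInstanceAs (Algebra (MvPolynomial (Var n) (Ground I))
    (FractionRing (MvPolynomial (Var n) (Ground I))))

instance (n : I → ℕ) : IsFractionRing (MvPolynomial (Var n) (Ground I)) (RatFun n) :=
  inferInstanceAs (IsFractionRing (MvPolynomial (Var n) (Ground I))
    (FractionRing (MvPolynomial (Var n) (Ground I))))

instance (n : I → ℕ) : Algebra (Ground I) (RatFun n) :=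
  inferInstanceAs (Algebra (Ground I) (FractionRing (MvPolynomial (Var n) (Ground I))))

instance (n : I → ℕ) : IsScalarTower (Ground I) (MvPolynomial (Var n) (Ground I)) (RatFun n) :=
  inferInstanceAs (IsScalarTower (Ground I) (MvPolynomial (Var n) (Ground I))
    (FractionRing (MvPolynomial (Var n) (Ground I))))

/-- The variable `z_{ia}` as a rational function. -/
def z {n : I → ℕ} (x : Var n) : RatFun n :=
  algebraMap (MvPolynomial (Var n) (Ground I)) _ (MvPolynomial.X x)

/-- Substitution `z_{ia} ↦ w_{ia}` in a Laurent polynomial, where the `w_{ia}` are elements of a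
field over the ground field (only used when they are all nonzero). -/
def substitute [Fintype I] {n : I → ℕ} {K : Type*} [Field K] [Algebra (Ground I) K]
    (w : Var n → K) : Laurent n →ₗ[Ground I] K :=
  (Finsupp.linearCombination (Ground I) fun d : Var n → ℤ => ∏ x, w x ^ d x) ∘ₗ
    (AddMonoidAlgebra.coeffLinearEquiv (Ground I)).toLinearMap

/-- The inclusion of Laurent polynomials into rational functions. -/
def toRatFun [Fintype I] (n : I → ℕ) : Laurent n →ₗ[Ground I] RatFun n := substitute z

/-- The Laurent polynomial `R` is symmetric in the variables `z_{i1}, …, z_{in_i}` for each vertex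
`i` separately. -/
def IsSymmetric {n : I → ℕ} (R : Laurent n) : Prop :=
  ∀ (π : ∀ i, Equiv.Perm (Fin (n i))) (d : Var n → ℤ),
    R.coeff (fun x => d ⟨x.1, π x.1 x.2⟩) = R.coeff d

/-- The wheel conditions: for every edge `e` from `i` to `j` and all `a ≠ c` (also different from
`b` if `i = j`), `R` vanishes when `z_{ia} = q z_{jb} / t_e = q z_{ic}`, and when
`z_{ja} = t_e z_{ib} = q z_{jc}`. -/
def Wheel [Fintype I] [DecidableEq I] {n : I → ℕ} (R : Laurent n) : Prop :=
  (∀ (i j : I) (e : i ⟶ j) (a c : Fin (n i)) (b : Fin (n j)),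
    (⟨i, a⟩ : Var n) ≠ ⟨i, c⟩ → (⟨i, a⟩ : Var n) ≠ ⟨j, b⟩ → (⟨j, b⟩ : Var n) ≠ ⟨i, c⟩ →
      substitute (Function.update (Function.update z
        ⟨i, a⟩ (q I • z ⟨i, c⟩)) ⟨j, b⟩ (t e • z ⟨i, c⟩) : Var n → RatFun n) R = 0) ∧
  (∀ (i j : I) (e : i ⟶ j) (a c : Fin (n j)) (b : Fin (n i)),
    (⟨j, a⟩ : Var n) ≠ ⟨j, c⟩ → (⟨j, a⟩ : Var n) ≠ ⟨i, b⟩ → (⟨i, b⟩ : Var n) ≠ ⟨j, c⟩ →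
      substitute (Function.update (Function.update z
        ⟨j, a⟩ (q I • z ⟨j, c⟩)) ⟨i, b⟩ ((q I / t e) • z ⟨j, c⟩) : Var n → RatFun n) R = 0)

/-- The degree `n` piece of the shuffle algebra: symmetric Laurent polynomials satisfying the wheel
conditions. -/
def shufflePiece [Fintype I] [DecidableEq I] (n : I → ℕ) : Submodule (Ground I) (Laurent n) where
  carrier := {R | IsSymmetric R ∧ Wheel R}
  zero_mem' := by
    refine ⟨fun π d => by simp, fun i j e a c b _ _ _ => by simp, fun i j e a c b _ _ _ => by simp⟩
  add_mem' := by
    rintro R S ⟨h1, h2, h3⟩ ⟨k1, k2, k3⟩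
    refine ⟨fun π d => by simp [h1 π d, k1 π d], fun i j e a c b x y w => ?_,
      fun i j e a c b x y w => ?_⟩
    · rw [map_add, h2 i j e a c b x y w, k2 i j e a c b x y w, add_zero]
    · rw [map_add, h3 i j e a c b x y w, k3 i j e a c b x y w, add_zero]
  smul_mem' := by
    rintro r R ⟨h1, h2, h3⟩
    refine ⟨fun π d => by simp [h1 π d], fun i j e a c b x y w => ?_,
      fun i j e a c b x y w => ?_⟩
    · rw [map_smul, h2 i j e a c b x y w, smul_zero]
    · rw [map_smul, h3 i j e a c b x y w, smul_zero]

/-- Renaming the variables of a rational function along an injection. -/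
def rename {n m : I → ℕ} (f : Var n ↪ Var m) : RatFun n →ₐ[Ground I] RatFun m :=
  IsFractionRing.liftAlgHom (A := MvPolynomial (Var n) (Ground I))
    (g := (IsScalarTower.toAlgHom (Ground I) (MvPolynomial (Var m) (Ground I)) (RatFun m)).comp
      (MvPolynomial.rename f))
    (by
      rw [AlgHom.coe_comp]
      exact (IsFractionRing.injective (MvPolynomial (Var m) (Ground I)) (RatFun m)).comp
        (MvPolynomial.rename_injective f f.injective))

/-- `z_{ia} ↦ z_{ia}` from degree `n` to degree `n + n'`. -/
def leftVar (n n' : I → ℕ) : Var n ↪ Var (n + n') :=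
  Function.Embedding.sigmaMap (Function.Embedding.refl I)
    fun i => (Fin.castAddEmb (n' i) : Fin (n i) ↪ Fin (n i + n' i))

/-- `z_{ib} ↦ z_{i, n_i + b}` from degree `n'` to degree `n + n'`. -/
def rightVar (n n' : I → ℕ) : Var n' ↪ Var (n + n') :=
  Function.Embedding.sigmaMap (Function.Embedding.refl I)
    fun i => (Fin.natAddEmb (n i) : Fin (n' i) ↪ Fin (n i + n' i))

/-- The permutation of the variables given by a permutation of `z_{i1}, …, z_{in_i}` for each
vertex `i`. -/
def permVar {n : I → ℕ} (π : ∀ i, Equiv.Perm (Fin (n i))) : Var n ↪ Var n :=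
  (Equiv.sigmaCongrRight π).toEmbedding

/-- Symmetrization (the sum over all permutations) in the variables `z_{i1}, …, z_{in_i}` for each
vertex `i` separately. -/
def sym [Fintype I] [DecidableEq I] (n : I → ℕ) : RatFun n →ₗ[Ground I] RatFun n :=
  ∑ π : (∀ i, Equiv.Perm (Fin (n i))), (rename (permVar π)).toLinearMap

/-- The function `ζ_{ij}`. -/
def zeta [DecidableEq I] [∀ i j : I, Fintype (i ⟶ j)] {K : Type*} [Field K] [Algebra (Ground I) K]
    (i j : I) (x : K) : K :=
  (if i = j then (1 - (q I)⁻¹ • x) / (1 - x) else 1) *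
    (∏ e : i ⟶ j, (1 - t e • x)) * ∏ e : j ⟶ i, (1 - (q I / t e) • x)

/-- The product of `ζ_{ij}(z_{ia} / z_{jb})` over all `1 ≤ a ≤ n_i` and `n_j < b ≤ n_j + n'_j`. -/
def kernel [Fintype I] [DecidableEq I] [∀ i j : I, Fintype (i ⟶ j)] (n n' : I → ℕ) :
    RatFun (n + n') :=
  ∏ x : Var n, ∏ y : Var n', zeta x.1 y.1 (z (leftVar n n' x) / z (rightVar n n' y))

/-- The shuffle product in degrees `n` and `n'`. -/
def shuffle [Fintype I] [DecidableEq I] [∀ i j : I, Fintype (i ⟶ j)] (n n' : I → ℕ) :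
    RatFun n →ₗ[Ground I] RatFun n' →ₗ[Ground I] RatFun (n + n') :=
  LinearMap.mk₂ (Ground I)
    (fun R R' => sym (n + n')
      ((((∏ i, (n i).factorial) * ∏ i, (n' i).factorial : ℕ) : Ground I)⁻¹ •
        (rename (leftVar n n') R * rename (rightVar n n') R' * kernel n n')))
    (fun R S R' => by rw [map_add, add_mul, add_mul, smul_add, map_add])
    (fun c R R' => by
      rw [map_smul (rename _), smul_mul_assoc, smul_mul_assoc, smul_comm, map_smul (sym _)])
    (fun R R' S => by rw [map_add, mul_add, add_mul, smul_add, map_add])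
    (fun c R R' => by
      rw [map_smul (rename _), mul_smul_comm, smul_mul_assoc, smul_comm, map_smul (sym _)])

end Functions

section Algebra

variable (I : Type u) [Quiver.{v} I]

/-- The direct sum over all degrees of the spaces of rational functions. The shuffle product is
defined on this space by its formula; the direct sum of the spaces of symmetric Laurent polynomials
is a subspace of it, and all algebras of interest live inside that subspace. -/
abbrev Total : Type (max u v) := ⨁ n : I → ℕ, RatFun n

variable [Fintype I] [DecidableEq I]

/-- The shuffle algebra: elements all of whose components are symmetric Laurent polynomials
satisfying the wheel conditions. -/
def shuffleAlgebra : Submodule (Ground I) (Total I) where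
  carrier := {F | ∀ n, F n ∈ (shufflePiece n).map (toRatFun n)}
  zero_mem' := fun _ => Submodule.zero_mem _
  add_mem' := fun hF hG n => Submodule.add_mem _ (hF n) (hG n)
  smul_mem' := fun c _ hF n => Submodule.smul_mem _ c (hF n)

/-- The inclusion of the degree `n` summand. -/
def inDegree (n : I → ℕ) : RatFun n →ₗ[Ground I] Total I :=
  DirectSum.lof (Ground I) (I → ℕ) (fun n => RatFun n) n

/-- The unit: the constant `1` in degree zero. -/
def one : Total I := inDegree I 0 1

/-- The shuffle product, extended bilinearly to the direct sum. -/
def mul [∀ i j : I, Fintype (i ⟶ j)] : Total I →ₗ[Ground I] Total I →ₗ[Ground I] Total I :=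
  DirectSum.toModule (Ground I) (I → ℕ) _ fun n =>
    (DirectSum.toModule (Ground I) (I → ℕ) _ fun n' =>
      ((shuffle n n').compr₂ (inDegree I (n + n'))).flip).flip

/-- The elements of degree `ς_i` of the shuffle algebra, for all vertices `i`. -/
def generators : Set (Total I) :=
  {F | ∃ i : I, ∃ R ∈ shufflePiece (Pi.single i 1 : I → ℕ), F = inDegree I _ (toRatFun _ R)}

/-- The spherical subalgebra: the smallest subspace that contains the unit and the elements of
degrees `ς_i`, and is closed under the shuffle product. -/
def sphericalAlgebra [∀ i j : I, Fintype (i ⟶ j)] : Submodule (Ground I) (Total I) :=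
  sInf {A | one I ∈ A ∧ generators I ⊆ A ∧ ∀ F ∈ A, ∀ G ∈ A, mul I F G ∈ A}

end Algebra

end

end QuiverShuffle

namespace WheelGraph

open MvPolynomial

section Collapse

variable {V F : Type*} [CommRing F]

theorem X_sub_X_ne_zero [Nontrivial F] {a b : V} (h : a ≠ b) :
    (X a - X b : MvPolynomial V F) ≠ 0 :=
  fun e => h (X_injective (sub_eq_zero.mp e))

theorem rename_X_sub_X_ne_zero [Nontrivial F] {a b : V} {g : V → V} (h : g a ≠ g b) :
    rename g (X a - X b : MvPolynomial V F) ≠ 0 := by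
  rw [map_sub, rename_X, rename_X]
  exact X_sub_X_ne_zero h

variable [DecidableEq V]

theorem X_sub_X_dvd_sub_rename (a b : V) (f : MvPolynomial V F) :
    (X a - X b) ∣ f - rename (Function.update id a b) f := by
  rw [← Ideal.mem_span_singleton, ← Ideal.Quotient.eq]
  have h : (Ideal.Quotient.mkₐ F (Ideal.span {(X a - X b : MvPolynomial V F)})) =
      (Ideal.Quotient.mkₐ F (Ideal.span {(X a - X b : MvPolynomial V F)})).comp
        (rename (Function.update id a b)) := by
    apply MvPolynomial.algHom_ext
    intro i
    by_cases hi : i = a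
    · subst hi
      simp only [AlgHom.comp_apply, rename_X, Function.update_self, Ideal.Quotient.mkₐ_eq_mk]
      rw [Ideal.Quotient.eq]
      exact Ideal.mem_span_singleton_self _
    · simp [hi]
  exact DFunLike.congr_fun h f

theorem X_sub_X_dvd_of_rename_eq_zero {a b : V} {f : MvPolynomial V F}
    (h : rename (Function.update id a b) f = 0) : (X a - X b) ∣ f := by
  simpa [h] using X_sub_X_dvd_sub_rename a b f

/-- A polynomial that vanishes on each of several distinct diagonals `X a = X b` is divisible by the
product of the corresponding linear forms. -/
theorem prod_X_sub_X_dvd [IsDomain F] (s : Finset (V × V)) (f : MvPolynomial V F)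
    (hf : ∀ p ∈ s, rename (Function.update id p.1 p.2) f = 0)
    (hs : ∀ p ∈ s, ∀ p' ∈ s, p ≠ p' →
      Function.update id p.1 p.2 p'.1 ≠ Function.update id p.1 p.2 p'.2) :
    (∏ p ∈ s, (X p.1 - X p.2)) ∣ f := by
  induction s using Finset.induction_on with
  | empty => simp
  | insert p s hp ih =>
    obtain ⟨g, hg⟩ := ih (fun p hp => hf p (Finset.mem_insert_of_mem hp))
      (fun p hp p' hp' => hs p (Finset.mem_insert_of_mem hp) p' (Finset.mem_insert_of_mem hp'))
    have h1 := hf p (Finset.mem_insert_self _ _)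
    rw [hg, map_mul, mul_eq_zero, map_prod, Finset.prod_eq_zero_iff] at h1
    rcases h1 with ⟨p', hp', h0⟩ | h1
    · exact absurd h0 (rename_X_sub_X_ne_zero (hs p (Finset.mem_insert_self _ _) p'
        (Finset.mem_insert_of_mem hp') (fun e => hp (e ▸ hp'))))
    · rw [Finset.prod_insert hp, hg, mul_comm (X p.1 - X p.2)]
      exact mul_dvd_mul_left _ (X_sub_X_dvd_of_rename_eq_zero h1)

theorem rename_update_rename_update {z w w' : V} (h : w ≠ z) (f : MvPolynomial V F) :
    rename (Function.update id z w') (rename (Function.update id z w) f) =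
      rename (Function.update id z w) f := by
  rw [rename_rename]
  congr 2
  ext v
  by_cases hv : v = z
  · subst hv; simp [h]
  · simp [hv]

/-- Lagrange interpolation of a polynomial in the variable `X z` at the nodes `X w`, `w ∈ T`, with
denominators cleared by a common multiple. -/
theorem exists_lagrange [IsDomain F] (z : V) (T : Finset V) (hz : z ∉ T) (f : MvPolynomial V F) :
    ∃ h : MvPolynomial V F,
      (∀ col : V → V, (∀ v, col v = z ↔ v = z) → rename col f = 0 → rename col h = 0) ∧
      ∀ (E : MvPolynomial V F) (Ej : V → MvPolynomial V F),
        (∀ w, rename (Function.update id z w) E = E) →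
        (∀ j ∈ T, E = Ej j * ∏ i ∈ T.erase j, (X i - X j)) →
        E * f = ∑ j ∈ T, Ej j * rename (Function.update id z j) f * ∏ i ∈ T.erase j, (X i - X z)
          + E * (∏ i ∈ T, (X i - X z)) * h := by
  induction T using Finset.induction_on with
  | empty => exact ⟨f, fun _ _ h => h, fun E Ej _ _ => by simp⟩
  | insert w T hw ih =>
    obtain ⟨h, hh, hE⟩ := ih (fun h => hz (Finset.mem_insert_of_mem h))
    have hwz : w ≠ z := fun e => hz (e ▸ Finset.mem_insert_self _ _)
    have hTz : ∀ j ∈ T, j ≠ z := fun j hj e => hz (e ▸ Finset.mem_insert_of_mem hj)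
    have hTw : ∀ j ∈ T, j ≠ w := fun j hj e => hw (e ▸ hj)
    obtain ⟨k, hk⟩ := X_sub_X_dvd_sub_rename z w h
    refine ⟨-k, fun col hcol hf0 => ?_, fun E Ej hEz hEj => ?_⟩
    · have h0 := hh col hcol hf0
      have h1 : rename col (rename (Function.update id z w) h) = 0 := by
        have e : col ∘ Function.update id z w = Function.update id z (col w) ∘ col := by
          ext v
          by_cases hv : v = z
          · subst hv; simp [(hcol v).2 rfl]
          · simp [hv, mt (hcol v).1 hv]
        rw [rename_rename, e, ← rename_rename, h0, map_zero]
      have h2 := congrArg (rename col) hk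
      rw [map_sub, h0, h1, sub_zero, map_mul, eq_comm, mul_eq_zero] at h2
      rw [map_neg, neg_eq_zero]
      refine h2.resolve_left (rename_X_sub_X_ne_zero ?_)
      rw [(hcol z).2 rfl]
      exact fun e => hwz ((hcol w).1 e.symm)
    · have herase : ∀ j ∈ T, (insert w T).erase j = insert w (T.erase j) := fun j hj =>
        Finset.erase_insert_of_ne (hTw j hj).symm
      have hnot : ∀ j, w ∉ T.erase j := fun j h => hw (Finset.mem_of_mem_erase h)
      have hEj' : ∀ j ∈ T, E = (Ej j * (X w - X j)) * ∏ i ∈ T.erase j, (X i - X j) := by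
        intro j hj
        rw [hEj j (Finset.mem_insert_of_mem hj), herase j hj, Finset.prod_insert (hnot j), mul_assoc]
      have hEw : E = Ej w * ∏ i ∈ T, (X i - X w) := by
        rw [hEj w (Finset.mem_insert_self _ _), Finset.erase_insert hw]
      have h1 := hE E (fun j => Ej j * (X w - X j)) hEz hEj'
      have hA0 : (∏ i ∈ T, (X i - X w) : MvPolynomial V F) ≠ 0 :=
        Finset.prod_ne_zero_iff.2 fun i hi => X_sub_X_ne_zero (hTw i hi)
      have hfree : ∀ j ∈ T, rename (Function.update id z w) (Ej j) * (X w - X j) =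
          Ej j * (X w - X j) := by
        intro j hj
        have hc0 : (∏ i ∈ T.erase j, (X i - X j) : MvPolynomial V F) ≠ 0 :=
          Finset.prod_ne_zero_iff.2 fun i hi => X_sub_X_ne_zero (Finset.ne_of_mem_erase hi)
        apply mul_right_cancel₀ hc0
        rw [← hEj' j hj]
        conv_rhs => rw [← hEz w, hEj' j hj]
        rw [map_mul, map_mul, map_prod]
        congr 1
        · simp [hwz, hTz j hj]
        · refine Finset.prod_congr rfl fun i hi => ?_
          simp [hTz j hj, hTz i (Finset.mem_of_mem_erase hi)]
      have h2 := congrArg (rename (Function.update id z w)) h1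
      have hprod : ∀ s ⊆ T, rename (Function.update id z w)
          (∏ i ∈ s, (X i - X z) : MvPolynomial V F) = ∏ i ∈ s, (X i - X w) := by
        intro s hs
        rw [map_prod]
        refine Finset.prod_congr rfl fun i hi => ?_
        simp [hTz i (hs hi)]
      rw [map_mul, hEz, map_add, map_sum, map_mul, map_mul, hEz, hprod T subset_rfl] at h2
      have h3 : ∀ j ∈ T, rename (Function.update id z w) (Ej j * (X w - X j) *
          rename (Function.update id z j) f * ∏ i ∈ T.erase j, (X i - X z)) =
          -(Ej j * rename (Function.update id z j) f * ∏ i ∈ T, (X i - X w)) := by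
        intro j hj
        rw [map_mul, map_mul, map_mul, rename_update_rename_update (hTz j hj),
          hprod _ (Finset.erase_subset _ _), ← Finset.mul_prod_erase T _ hj]
        have e : rename (Function.update id z w) (X w - X j : MvPolynomial V F) = X w - X j := by
          simp [hwz, hTz j hj]
        rw [e, hfree j hj]
        ring
      rw [Finset.sum_congr rfl h3, Finset.sum_neg_distrib, ← Finset.sum_mul] at h2
      have h4 : E * rename (Function.update id z w) h =
          Ej w * rename (Function.update id z w) f +
            ∑ j ∈ T, Ej j * rename (Function.update id z j) f := by
        apply mul_right_cancel₀ hA0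
        conv_lhs at h2 => rw [hEw]
        linear_combination (-1 : MvPolynomial V F) * h2
      rw [h1, Finset.sum_insert hw, Finset.erase_insert hw, Finset.prod_insert hw]
      have h5 : ∀ j ∈ T, Ej j * (X w - X j) * rename (Function.update id z j) f *
            ∏ i ∈ T.erase j, (X i - X z) =
          Ej j * rename (Function.update id z j) f * ∏ i ∈ (insert w T).erase j, (X i - X z) -
            Ej j * rename (Function.update id z j) f * ∏ i ∈ T, (X i - X z) := by
        intro j hj
        rw [herase j hj, Finset.prod_insert (hnot j), ← Finset.mul_prod_erase T _ hj]
        ring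
      rw [Finset.sum_congr rfl h5, Finset.sum_sub_distrib, ← Finset.sum_mul]
      linear_combination (∏ i ∈ T, (X i - X z)) * h4 + E * (∏ i ∈ T, (X i - X z)) * hk

end Collapse

section Insert

theorem exists_insert_order {V : Type*} [DecidableEq V] (Y : Finset V) (z : V) (hz : z ∉ Y)
    (ρ : V → ℤ) (hρ : Set.InjOn ρ Y) (lo hi : V → Prop)
    (h : ∀ a ∈ Y, ∀ b ∈ Y, lo a → hi b → ρ a < ρ b) :
    ∃ ρ' : V → ℤ, Set.InjOn ρ' (insert z Y : Finset V) ∧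
      (∀ a ∈ Y, ∀ b ∈ Y, ρ' a < ρ' b ↔ ρ a < ρ b) ∧
      (∀ a ∈ Y, lo a → ρ' a < ρ' z) ∧ ∀ b ∈ Y, hi b → ρ' z < ρ' b := by
  classical
  obtain ⟨r, hr1, hr2⟩ : ∃ r : ℤ, (∀ a ∈ Y, lo a → ρ a ≤ r) ∧ ∀ b ∈ Y, hi b → r < ρ b := by
    rcases (Y.filter hi).eq_empty_or_nonempty with he | hne
    · obtain ⟨r, hr⟩ := (Y.image ρ).exists_le
      refine ⟨r, fun a ha _ => hr _ (Finset.mem_image_of_mem _ ha), fun b hb hb' => ?_⟩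
      have : b ∈ Y.filter hi := Finset.mem_filter.2 ⟨hb, hb'⟩
      simp [he] at this
    · obtain ⟨b₀, hb₀, hmin⟩ := (Y.filter hi).exists_min_image ρ hne
      rw [Finset.mem_filter] at hb₀
      refine ⟨ρ b₀ - 1, fun a ha ha' => ?_, fun b hb hb' => ?_⟩
      · have := h a ha b₀ hb₀.1 ha' hb₀.2
        omega
      · have := hmin b (Finset.mem_filter.2 ⟨hb, hb'⟩)
        omega
  have hne : ∀ a ∈ Y, a ≠ z := fun a ha e => hz (e ▸ ha)
  refine ⟨fun v => if v = z then 2 * r + 1 else 2 * ρ v, ?_, ?_, ?_, ?_⟩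
  · intro a ha b hb hab
    simp only [Finset.coe_insert, Set.mem_insert_iff, Finset.mem_coe] at ha hb
    rcases ha with rfl | ha <;> rcases hb with rfl | hb
    · rfl
    · simp only [if_true, hne b hb, if_false] at hab
      omega
    · simp only [if_true, hne a ha, if_false] at hab
      omega
    · simp only [hne a ha, hne b hb, if_false] at hab
      exact hρ ha hb (by omega)
  · intro a ha b hb
    simp only [hne a ha, hne b hb, if_false]
    omega
  · intro a ha ha'
    simp only [hne a ha, if_false, if_true]
    have := hr1 a ha ha'
    omega
  · intro b hb hb'
    simp only [hne b hb, if_false, if_true]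
    have := hr2 b hb hb'
    omega

end Insert

end WheelGraph

section

open MvPolynomial

/-- The local combinatorial model of a configuration of variables: an edge `up x y` raises the level
by one, `top z w` says that `w` sits two levels above `z` at `q` times its position, and `sim` is
the relation of sitting at the same position with the same colour. -/
structure WheelGraph (V : Type*) where
  up : V → V → Prop
  top : V → V → Prop
  sim : V → V → Prop
  lev : V → ℤ
  ord : V → ℕ
  up_lev : ∀ {x y}, up x y → lev y = lev x + 1
  top_lev : ∀ {x y}, top x y → lev y = lev x + 2
  diamond : ∀ {z w}, top z w → ∀ y, up z y ↔ up y w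
  top_sim : ∀ {z w w'}, top z w → top z w' → sim w w'
  sim_ord : ∀ {a b}, sim a b → ord a = ord b → a = b

namespace WheelGraph

noncomputable section

open Classical in
/-- The substitution identifying three variables. -/
def collapse {V : Type*} (x y w : V) (v : V) : V := if v = x ∨ v = y then w else v

variable {V : Type*} (F : Type*) [CommRing F] (G : WheelGraph V)

/-- The arrows `a → b` that have to be paid for when `a` precedes `b`. -/
def Soft (len : V → ℕ) (a b : V) : Prop := (G.up a b ∧ len b ≤ len a) ∨ G.top b a

open Classical in
/-- The pairs of vertices that are in the wrong order. -/
def viol (S : Finset V) (len : V → ℕ) (ρ : V → ℤ) : Finset (V × V) :=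
  (S ×ˢ S).filter fun p => G.Soft len p.1 p.2 ∧ ρ p.1 < ρ p.2

/-- The constraints on the orders that are allowed while the vertices of level `l` are removed. -/
def Hard (l : ℤ) (S : Finset V) (len : V → ℕ) (ρ : V → ℤ) : Prop :=
  ∀ x ∈ S, ∀ y ∈ S, G.lev y ≤ l + 1 → G.lev y ≤ G.lev x → len y < len x → ρ y < ρ x

/-- The ideal spanned by the products of the linear forms of the violated arrows. -/
def orderIdeal (l : ℤ) (S : Finset V) (len : V → ℕ) : Ideal (MvPolynomial V F) :=
  Ideal.span {N | ∃ ρ : V → ℤ, Set.InjOn ρ S ∧ G.Hard l S len ρ ∧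
    N = ∏ p ∈ G.viol S len ρ, (X p.1 - X p.2)}

open Classical in
/-- The pairs of variables of equal colour and position that have not been merged. -/
def pairs (S : Finset V) (len : V → ℕ) : Finset (V × V) :=
  (S ×ˢ S).filter fun p => (G.sim p.1 p.2 ∧ G.ord p.1 < G.ord p.2) ∧ len p.1 = 1 ∧ len p.2 = 1

/-- The product of the differences of the variables of equal colour and position that have not been
merged. -/
def vand (S : Finset V) (len : V → ℕ) : MvPolynomial V F :=
  ∏ p ∈ G.pairs S len, (X p.1 - X p.2)

variable {F}

/-- The wheel conditions: `f` vanishes when the variables of an oriented triangle coincide. -/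
def IsWheel (S : Finset V) (len : V → ℕ) (f : MvPolynomial V F) : Prop :=
  ∀ x ∈ S, ∀ y ∈ S, ∀ w ∈ S, G.up x y → G.top x w → len y ≤ len x → len w ≤ len y →
    rename (collapse x y w) f = 0

variable {G}

theorem Hard.of_le {l l' : ℤ} (h : l ≤ l') {S : Finset V} {len : V → ℕ} {ρ : V → ℤ}
    (H : G.Hard l' S len ρ) : G.Hard l S len ρ :=
  fun x hx y hy h1 h2 h3 => H x hx y hy (by omega) h2 h3

theorem orderIdeal_anti {l l' : ℤ} (h : l ≤ l') {S : Finset V} {len : V → ℕ} :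
    G.orderIdeal F l' S len ≤ G.orderIdeal F l S len := by
  apply Ideal.span_mono
  rintro N ⟨ρ, h1, h2, h3⟩
  exact ⟨ρ, h1, h2.of_le h, h3⟩

open Classical in
theorem rename_vand_eq {S : Finset V} {len : V → ℕ} {z w : V} (hz : z ∉ S) :
    rename (Function.update id z w) (G.vand F S len) = G.vand F S len := by
  rw [vand, map_prod]
  refine Finset.prod_congr rfl fun p hp => ?_
  simp only [pairs, Finset.mem_filter, Finset.mem_product] at hp
  have h1 : p.1 ≠ z := fun e => hz (e ▸ hp.1.1)
  have h2 : p.2 ≠ z := fun e => hz (e ▸ hp.1.2)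
  simp [h1, h2]

open Classical in
theorem vand_erase_dvd (S : Finset V) (len : V → ℕ) (z : V) :
    G.vand F (S.erase z) len ∣ G.vand F S len := by
  apply Finset.prod_dvd_prod_of_subset
  intro p hp
  simp only [pairs, Finset.mem_filter, Finset.mem_product, Finset.mem_erase] at hp ⊢
  exact ⟨⟨hp.1.1.2, hp.1.2.2⟩, hp.2⟩

open Classical in
theorem vand_update_mul_dvd {S : Finset V} {len : V → ℕ} {w : V} {k : ℕ} (hk : k ≠ 1) (hw : w ∈ S)
    (hlw : len w = 1) (T : Finset V) (hT : ∀ i ∈ T, i ∈ S ∧ len i = 1)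
    (hsim : ∀ i ∈ T, G.sim i w ∧ G.sim w i) (hwT : w ∉ T) :
    (G.vand F S (Function.update len w k) * ∏ i ∈ T, (X i - X w)) ∣ G.vand F S len := by
  set Q := T.image fun i => if G.ord i < G.ord w then (i, w) else (w, i) with hQ
  have hdisj : Disjoint (G.pairs S (Function.update len w k)) Q := by
    rw [Finset.disjoint_left]
    intro p hp hp'
    simp only [pairs, Finset.mem_filter] at hp
    obtain ⟨i, hi, rfl⟩ := Finset.mem_image.1 hp'
    split_ifs at hp with h
    · simp [hk] at hp
    · simp [hk] at hp
  have hsub : G.pairs S (Function.update len w k) ∪ Q ⊆ G.pairs S len := by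
    intro p hp
    rcases Finset.mem_union.1 hp with hp | hp
    · simp only [pairs, Finset.mem_filter] at hp ⊢
      have h1 : p.1 ≠ w := by rintro e; simp [e, hk] at hp
      have h2 : p.2 ≠ w := by rintro e; simp [e, hk] at hp
      simpa [h1, h2] using hp
    · obtain ⟨i, hi, rfl⟩ := Finset.mem_image.1 hp
      have hiw : i ≠ w := fun e => hwT (e ▸ hi)
      simp only [pairs, Finset.mem_filter, Finset.mem_product]
      split_ifs with h
      · exact ⟨⟨(hT i hi).1, hw⟩, ⟨(hsim i hi).1, h⟩, (hT i hi).2, hlw⟩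
      · refine ⟨⟨hw, (hT i hi).1⟩, ⟨(hsim i hi).2, ?_⟩, hlw, (hT i hi).2⟩
        exact lt_of_le_of_ne (not_lt.1 h) fun e => hiw (G.sim_ord (hsim i hi).1 e.symm)
  refine dvd_trans ?_ (Finset.prod_dvd_prod_of_subset _ _ _ hsub)
  rw [Finset.prod_union hdisj]
  apply mul_dvd_mul_left
  rw [hQ, Finset.prod_image]
  · refine Finset.prod_dvd_prod_of_dvd _ _ fun i _ => ?_
    split_ifs
    · exact dvd_rfl
    · exact ⟨-1, by ring⟩
  · intro i hi j hj hij
    have hiw : i ≠ w := fun e => hwT (e ▸ hi)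
    have hjw : j ≠ w := fun e => hwT (e ▸ hj)
    dsimp only at hij
    split_ifs at hij <;> simp_all

end

end WheelGraph

end

section

open MvPolynomial

namespace WheelGraph

open Classical in
/-- Inserting a vertex of lowest level into the admissible orders of the other vertices. -/
theorem mul_mem_orderIdeal_of_erase {V F : Type*} [CommRing F] {G : WheelGraph V} {l : ℤ}
    {S : Finset V} {len len' : V → ℕ} {z : V} (hz : z ∈ S) (hzl : G.lev z = l)
    (hl : ∀ x ∈ S, l ≤ G.lev x) (hmax : ∀ x ∈ S, G.lev x = l → len x ≤ len z)
    (h₁ : ∀ v ∈ S.erase z, G.lev v ≤ l + 1 → len' v = len v)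
    (h₂ : ∀ v ∈ S.erase z, len v ≤ len' v)
    (A : Finset V) (h₃ : ∀ a ∈ S.erase z, G.top z a → a ∈ A ∨ len z < len' a)
    (B : Finset (V × V)) (h₄ : ∀ ρ : V → ℤ, G.Hard l (S.erase z) len' ρ →
      ∀ a ∈ S.erase z, ∀ b ∈ S.erase z, G.Soft len a b → ρ a < ρ b →
        G.Soft len' a b ∨ (a, b) ∈ B)
    {g : MvPolynomial V F} (hg : g ∈ G.orderIdeal F l (S.erase z) len') :
    (∏ p ∈ B, (X p.1 - X p.2)) * (∏ a ∈ A, (X a - X z)) * g ∈ G.orderIdeal F l S len := by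
  refine Submodule.span_induction ?_ (by simp) ?_ ?_ hg
  · rintro N ⟨ρ, hinj, hhard, rfl⟩
    obtain ⟨ρ', hinj', hord, hlo, hhi⟩ := exists_insert_order (S.erase z) z
      (Finset.notMem_erase _ _) ρ hinj
      (fun v => (G.up z v ∧ len v ≤ len z) ∨ (G.lev v = l ∧ len v < len z))
      (fun v => len z < len' v) (by
        intro a ha b hb hlo hhi
        have ha1 : G.lev a ≤ l + 1 ∧ len a ≤ len z := by
          rcases hlo with ⟨h, h'⟩ | ⟨h, h'⟩
          · exact ⟨by rw [G.up_lev h, hzl], h'⟩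
          · exact ⟨by omega, h'.le⟩
        have hb1 := hl b (Finset.mem_of_mem_erase hb)
        refine hhard b hb a ha ha1.1 ?_ (by rw [h₁ a ha ha1.1]; omega)
        by_contra hlt
        have hbl : G.lev b = l := by omega
        have := hmax b (Finset.mem_of_mem_erase hb) hbl
        rw [h₁ b hb (by omega)] at hhi
        omega)
    rw [Finset.insert_erase hz] at hinj'
    have hhard' : G.Hard l S len ρ' := by
      intro x hx y hy h1 h2 h3
      by_cases hxz : x = z
      · by_cases hyz : y = z
        · subst hxz hyz; exact absurd h3 (lt_irrefl _)
        · subst hxz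
          have := hl y hy
          exact hlo y (Finset.mem_erase.2 ⟨hyz, hy⟩) (Or.inr ⟨by omega, h3⟩)
      · have hx' := Finset.mem_erase.2 ⟨hxz, hx⟩
        by_cases hyz : y = z
        · subst hyz
          exact hhi x hx' (lt_of_lt_of_le h3 (h₂ x hx'))
        · have hy' := Finset.mem_erase.2 ⟨hyz, hy⟩
          rw [hord y hy' x hx']
          exact hhard x hx' y hy' h1 h2 (by
            rw [h₁ y hy' h1]; exact lt_of_lt_of_le h3 (h₂ x hx'))
    have hsub : G.viol S len ρ' ⊆
        (B ∪ A.image fun a => (a, z)) ∪ G.viol (S.erase z) len' ρ := by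
      rintro ⟨a, b⟩ hp
      simp only [viol, Finset.mem_filter, Finset.mem_product] at hp
      obtain ⟨⟨ha, hb⟩, hs, hlt⟩ := hp
      rw [Finset.mem_union, Finset.mem_union]
      by_cases haz : a = z
      · subst haz
        by_cases hbz : b = a
        · subst hbz; exact absurd hlt (lt_irrefl _)
        · have hb' := Finset.mem_erase.2 ⟨hbz, hb⟩
          rcases hs with hs | hs
          · exact absurd (hlo b hb' (Or.inl hs)) (not_lt.2 hlt.le)
          · have := G.top_lev hs
            have := hl b hb
            omega
      · have ha' := Finset.mem_erase.2 ⟨haz, ha⟩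
        by_cases hbz : b = z
        · subst hbz
          rcases hs with hs | hs
          · have := G.up_lev hs.1
            have := hl a ha
            omega
          · rcases h₃ a ha' hs with h | h
            · exact Or.inl (Or.inr (Finset.mem_image.2 ⟨a, h, rfl⟩))
            · exact absurd (hhi a ha' h) (not_lt.2 hlt.le)
        · have hb' := Finset.mem_erase.2 ⟨hbz, hb⟩
          rw [hord a ha' b hb'] at hlt
          rcases h₄ ρ hhard a ha' b hb' hs hlt with h | h
          · right
            simp only [viol, Finset.mem_filter, Finset.mem_product]
            exact ⟨⟨ha', hb'⟩, h, hlt⟩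
          · exact Or.inl (Or.inl h)
    have hunion : ∀ (s t : Finset (V × V)) (φ : V × V → MvPolynomial V F),
        (∏ p ∈ s ∪ t, φ p) ∣ (∏ p ∈ s, φ p) * ∏ p ∈ t, φ p := fun s t φ =>
      ⟨∏ p ∈ s ∩ t, φ p, (Finset.prod_union_inter).symm⟩
    have hdvd : (∏ p ∈ G.viol S len ρ', (X p.1 - X p.2 : MvPolynomial V F)) ∣
        (∏ p ∈ B, (X p.1 - X p.2)) * (∏ a ∈ A, (X a - X z)) *
          ∏ p ∈ G.viol (S.erase z) len' ρ, (X p.1 - X p.2) := by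
      refine (Finset.prod_dvd_prod_of_subset _ _ _ hsub).trans ((hunion _ _ _).trans ?_)
      refine mul_dvd_mul_right ((hunion _ _ _).trans ?_) _
      rw [Finset.prod_image (by intro a _ b _ h; exact (Prod.ext_iff.1 h).1)]
    exact Ideal.mem_of_dvd _ hdvd (Ideal.subset_span ⟨ρ', hinj', hhard', rfl⟩)
  · intro x y _ _ hx hy
    rw [mul_add]
    exact Ideal.add_mem _ hx hy
  · intro a x _ hx
    rw [smul_eq_mul, mul_left_comm]
    exact Ideal.mul_mem_left _ a hx

open Classical in
theorem vand_mul_mem_orderIdeal {V F : Type*} [CommRing F] [IsDomain F] (G : WheelGraph V) (n : ℕ) :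
    ∀ (S : Finset V) (len : V → ℕ) (l : ℤ), S.card = n →
      (∀ x ∈ S, l ≤ G.lev x) → (∀ x ∈ S, 1 ≤ len x) →
      (∀ x ∈ S, l + 3 ≤ G.lev x → len x = 1) →
      (∀ x ∈ S, G.lev x = l + 2 → len x = 1 ∨ ∀ z ∈ S, G.lev z = l → len z < len x) →
      ∀ f : MvPolynomial V F, G.IsWheel S len f → G.vand F S len * f ∈ G.orderIdeal F l S len := by
  induction n with
  | zero =>
    intro S len l hS _ _ _ _ f _
    rw [Finset.card_eq_zero] at hS
    subst hS
    have : (1 : MvPolynomial V F) ∈ G.orderIdeal F l ∅ len :=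
      Ideal.subset_span ⟨0, by simp, by intro x hx; simp at hx, by simp [viol]⟩
    exact Ideal.mul_mem_left _ _ (by simpa using Ideal.mul_mem_left _ f this)
  | succ n ih =>
    intro S len l₀ hS hl₀ hpos h3₀ h2₀ f hf
    obtain ⟨z₀, hz₀, hmin⟩ := S.exists_min_image G.lev (Finset.card_pos.1 (by omega))
    obtain ⟨l, hl⟩ : ∃ l, G.lev z₀ = l := ⟨_, rfl⟩
    have hll : l₀ ≤ l := hl ▸ hl₀ z₀ hz₀
    refine orderIdeal_anti hll ?_
    have hlS : ∀ x ∈ S, l ≤ G.lev x := fun x hx => hl ▸ hmin x hx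
    have h3 : ∀ x ∈ S, l + 3 ≤ G.lev x → len x = 1 := fun x hx h => h3₀ x hx (by omega)
    have h2 : ∀ x ∈ S, G.lev x = l + 2 → len x = 1 ∨ ∀ z ∈ S, G.lev z = l → len z < len x := by
      intro x hx h
      rcases eq_or_lt_of_le hll with rfl | hlt
      · exact h2₀ x hx h
      · exact Or.inl (h3₀ x hx (by omega))
    obtain ⟨z, hz, hkmax⟩ := (S.filter fun x => G.lev x = l).exists_max_image len
      ⟨z₀, Finset.mem_filter.2 ⟨hz₀, hl⟩⟩
    rw [Finset.mem_filter] at hz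
    obtain ⟨hz, hzl⟩ := hz
    replace hkmax : ∀ x ∈ S, G.lev x = l → len x ≤ len z := fun x hx h =>
      hkmax x (Finset.mem_filter.2 ⟨hx, h⟩)
    have hcard : (S.erase z).card = n := by rw [Finset.card_erase_of_mem hz, hS]; rfl
    set T := S.filter fun w => G.top z w ∧ len w = 1 with hT
    have hzT : z ∉ T := by
      intro h
      have := G.top_lev (Finset.mem_filter.1 h).2.1
      omega
    have hTm : ∀ w ∈ T, w ∈ S.erase z ∧ G.top z w ∧ len w = 1 := fun w hw =>
      ⟨Finset.mem_erase.2 ⟨fun e => hzT (e ▸ hw), (Finset.mem_filter.1 hw).1⟩,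
        (Finset.mem_filter.1 hw).2⟩
    have hlevT : ∀ w ∈ T, G.lev w = l + 2 := fun w hw => by rw [G.top_lev (hTm w hw).2.1, hzl]
    obtain ⟨h, hh, hE⟩ := exists_lagrange z T hzT f
    have hme : ∀ x, x ∈ S.erase z → x ∈ S := fun x hx => Finset.mem_of_mem_erase hx
    have htop2 : ∀ a ∈ S.erase z, G.top z a → a ∈ T ∨ len z < len a := by
      intro a ha hza
      rcases h2 a (hme a ha) (by rw [G.top_lev hza, hzl]) with h | h
      · exact Or.inl (Finset.mem_filter.2 ⟨hme a ha, hza, h⟩)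
      · exact Or.inr (h z hz hzl)
    -- the common multiple of the denominators, and the cofactors
    have hdvd : ∀ w, w ∈ T → (G.vand F (S.erase z) (Function.update len w (len z + 1)) *
        ∏ i ∈ T.erase w, (X i - X w)) ∣ G.vand F (S.erase z) len := by
      intro w hw
      have := hpos z hz
      apply vand_update_mul_dvd (by omega) (hTm w hw).1 (hTm w hw).2.2
      · intro i hi
        have := hTm i (Finset.mem_of_mem_erase hi)
        exact ⟨this.1, this.2.2⟩
      · intro i hi
        have := hTm i (Finset.mem_of_mem_erase hi)
        exact ⟨G.top_sim this.2.1 (hTm w hw).2.1, G.top_sim (hTm w hw).2.1 this.2.1⟩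
      · exact Finset.notMem_erase _ _
    choose! c hc using hdvd
    have hmain := hE (G.vand F (S.erase z) len)
      (fun j => G.vand F (S.erase z) (Function.update len j (len z + 1)) * c j)
      (fun w => rename_vand_eq (Finset.notMem_erase _ _)) (fun j hj => by
        conv_lhs => rw [hc j hj]
        ring)
    suffices hsuff : G.vand F (S.erase z) len * f ∈ G.orderIdeal F l S len from
      Ideal.mem_of_dvd _ (mul_dvd_mul_right (vand_erase_dvd S len z) f) hsuff
    rw [hmain]
    refine Ideal.add_mem _ (Ideal.sum_mem _ fun w hw => ?_) ?_
    · -- the terms where `z` is merged with `w`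
      obtain ⟨hwS, hzw, hlw⟩ := hTm w hw
      have hwz : w ≠ z := Finset.ne_of_mem_erase hwS
      have hwl := hlevT w hw
      set Y := S.filter fun y => G.up z y ∧ len y ≤ len z with hY
      have hYm : ∀ y ∈ Y, y ∈ S ∧ G.up z y ∧ len y ≤ len z := fun y hy => Finset.mem_filter.1 hy
      have hYl : ∀ y ∈ Y, G.lev y = l + 1 := fun y hy => by rw [G.up_lev (hYm y hy).2.1, hzl]
      have hYw : ∀ y ∈ Y, y ≠ w := fun y hy e => by
        have := hYl y hy
        rw [e] at this
        omega
      have hYz : ∀ y ∈ Y, y ≠ z := fun y hy e => by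
        have := hYl y hy
        rw [e] at this
        omega
      set B := Y.image fun y => (y, w) with hB
      obtain ⟨g, hg⟩ : (∏ p ∈ B, (X p.1 - X p.2)) ∣ rename (Function.update id z w) f := by
        apply prod_X_sub_X_dvd
        · intro p hp
          obtain ⟨y, hy, rfl⟩ := Finset.mem_image.1 hp
          have hcyc := hf z hz y (hYm y hy).1 w (hme w hwS) (hYm y hy).2.1 hzw (hYm y hy).2.2
            (by rw [hlw]; exact hpos y (hYm y hy).1)
          rw [rename_rename, ← hcyc]
          congr 2
          ext v
          simp only [Function.comp_apply, collapse]
          by_cases hvz : v = z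
          · simp [hvz, Function.update_of_ne (hYw y hy).symm]
          · by_cases hvy : v = y
            · simp [hvy, hYz y hy]
            · simp [hvz, hvy]
        · intro p hp p' hp' hpp
          obtain ⟨y, hy, rfl⟩ := Finset.mem_image.1 hp
          obtain ⟨y', hy', rfl⟩ := Finset.mem_image.1 hp'
          have hne : y' ≠ y := by rintro rfl; exact hpp rfl
          simp [Function.update_of_ne hne, Function.update_of_ne (hYw y hy).symm, hYw y' hy']
      set len' := Function.update len w (len z + 1) with hlen'
      have hlenw : len' w = len z + 1 := Function.update_self _ _ _
      have hlen : ∀ v, v ≠ w → len' v = len v := fun v hv => Function.update_of_ne hv _ _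
      have hgw : G.IsWheel (S.erase z) len' g := by
        intro x hx y hy v hv hxy hxv hl1 hl2
        have hxl := G.up_lev hxy
        have hvl := G.top_lev hxv
        have hyx : y ≠ x := by rintro rfl; omega
        have hvx : v ≠ x := by rintro rfl; omega
        have hvy : v ≠ y := by rintro rfl; omega
        have hvw : v ≠ w := by
          rintro rfl
          have hyw : y ≠ v := by rintro rfl; omega
          have hxw : x ≠ v := by rintro rfl; omega
          rw [hlenw] at hl2
          rw [hlen x hxw] at hl1
          have := hkmax x (hme x hx) (by omega)
          omega
        have hvl1 : x = w ∨ y = w → len v = 1 := by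
          intro hor
          apply h3 v (hme v hv)
          rcases hor with rfl | rfl <;> omega
        have hcyc : rename (collapse x y v) f = 0 := by
          refine hf x (hme x hx) y (hme y hy) v (hme v hv) hxy hxv ?_ ?_
          · by_cases hxw : x = w
            · subst hxw
              rw [h3 y (hme y hy) (by omega)]
              exact hpos x (hme x hx)
            · by_cases hyw : y = w
              · subst hyw
                rw [hlw]
                exact hpos x (hme x hx)
              · rwa [hlen x hxw, hlen y hyw] at hl1
          · by_cases hor : x = w ∨ y = w
            · rw [hvl1 hor]
              exact hpos y (hme y hy)
            · push Not at hor
              rwa [hlen y hor.2, hlen v hvw] at hl2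
        have hxz := Finset.ne_of_mem_erase hx
        have hyz := Finset.ne_of_mem_erase hy
        have hvz := Finset.ne_of_mem_erase hv
        have h0 := congrArg (rename (collapse x y v)) hg
        have hcomp : collapse x y v ∘ Function.update id z w =
            Function.update id z (collapse x y v w) ∘ collapse x y v := by
          ext u
          by_cases hu : u = z
          · subst hu
            have : collapse x y v u = u := by simp [collapse, hxz.symm, hyz.symm]
            simp [this]
          · have : collapse x y v u ≠ z := by
              unfold collapse
              split_ifs
              · exact hvz
              · exact hu
            simp [hu, this]
        rw [rename_rename, hcomp, ← rename_rename, hcyc, map_zero, map_mul, eq_comm,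
          mul_eq_zero] at h0
        refine h0.resolve_left ?_
        rw [map_prod]
        refine Finset.prod_ne_zero_iff.2 fun p hp => ?_
        obtain ⟨u, hu, rfl⟩ := Finset.mem_image.1 hp
        apply rename_X_sub_X_ne_zero
        dsimp only
        have hul := hYl u hu
        have huw := hYw u hu
        intro heq
        unfold collapse at heq
        split_ifs at heq with e1 e2 e2
        · rcases e1 with rfl | rfl
          · rcases e2 with rfl | rfl
            · exact huw rfl
            · rw [hlenw, hlen u huw] at hl1
              have := (hYm u hu).2.2
              omega
          · rcases e2 with rfl | rfl
            · omega
            · exact huw rfl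
        · exact hvw heq
        · rw [heq] at hul
          rcases e2 with rfl | rfl <;> omega
        · exact huw heq
      have hgI := ih (S.erase z) len' l hcard (fun x hx => hlS x (hme x hx))
        (by
          intro x hx
          by_cases hxw : x = w
          · subst hxw; rw [hlenw]; omega
          · rw [hlen x hxw]; exact hpos x (hme x hx))
        (by
          intro x hx hx3
          rw [hlen x (by rintro rfl; omega)]
          exact h3 x (hme x hx) hx3)
        (by
          intro x hx hx2
          by_cases hxw : x = w
          · right
            intro u hu hul
            rw [hxw, hlenw, hlen u (by rintro rfl; omega)]
            have := hkmax u (hme u hu) hul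
            omega
          · rw [hlen x hxw]
            refine (h2 x (hme x hx) hx2).imp id fun H u hu hul => ?_
            rw [hlen u (by rintro rfl; omega)]
            exact H u (hme u hu) hul)
        g hgw
      have hins := mul_mem_orderIdeal_of_erase (F := F) (len' := len') hz hzl hlS hkmax
        (by
          intro v hv hvl
          exact hlen v (by rintro rfl; omega))
        (by
          intro v hv
          by_cases hvw : v = w
          · subst hvw; rw [hlenw, hlw]; omega
          · rw [hlen v hvw])
        (T.erase w)
        (by
          intro a ha hza
          by_cases haw : a = w
          · right; rw [haw, hlenw]; omega
          · rw [hlen a haw]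
            exact (htop2 a ha hza).imp (fun h => Finset.mem_erase.2 ⟨haw, h⟩) id)
        B
        (by
          intro ρ _ a ha b hb hs hlt
          rcases hs with ⟨hab, hle⟩ | hs
          · by_cases hbw : b = w
            · subst hbw
              have haw : a ≠ b := by rintro rfl; exact lt_irrefl _ hlt
              by_cases hka : len z + 1 ≤ len a
              · left; left
                rw [hlenw, hlen a haw]
                exact ⟨hab, hka⟩
              · right
                refine Finset.mem_image.2 ⟨a, Finset.mem_filter.2 ⟨hme a ha, ?_, by omega⟩, rfl⟩
                exact (G.diamond hzw a).2 hab
            · left; left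
              refine ⟨hab, ?_⟩
              rw [hlen b hbw]
              by_cases haw : a = w
              · subst haw; rw [hlenw]; omega
              · rwa [hlen a haw]
          · exact Or.inl (Or.inr hs))
        hgI
      rw [hg]
      convert Ideal.mul_mem_left _ (c w) hins using 1
      ring
    · -- the remainder
      have hhw : G.IsWheel (S.erase z) len h := by
        intro x hx y hy v hv hxy hxv hl1 hl2
        refine hh _ ?_ (hf x (hme x hx) y (hme y hy) v (hme v hv) hxy hxv hl1 hl2)
        have hxz := Finset.ne_of_mem_erase hx
        have hyz := Finset.ne_of_mem_erase hy
        have hvz := Finset.ne_of_mem_erase hv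
        intro u
        unfold collapse
        split_ifs with hu
        · refine ⟨fun e => absurd e hvz, fun e => ?_⟩
          subst e
          rcases hu with rfl | rfl
          · exact absurd rfl hxz
          · exact absurd rfl hyz
        · rfl
      have hhI := ih (S.erase z) len l hcard (fun x hx => hlS x (hme x hx))
        (fun x hx => hpos x (hme x hx)) (fun x hx => h3 x (hme x hx))
        (fun x hx hx2 => (h2 x (hme x hx) hx2).imp id fun H u hu => H u (hme u hu)) h hhw
      have hins := mul_mem_orderIdeal_of_erase (F := F) (len' := len) hz hzl hlS hkmax
        (fun _ _ _ => rfl) (fun _ _ => le_rfl) T htop2 ∅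
        (fun _ _ _ _ _ _ hs _ => Or.inl hs) hhI
      convert hins using 1
      rw [Finset.prod_empty]
      ring

end WheelGraph

end

universe u v

namespace QuiverShuffle

noncomputable section

section GroundField

variable {I : Type u} [Quiver.{v} I]

theorem algebraMap_ground_injective :
    Function.Injective (algebraMap (MvPolynomial (Option (Edges I)) ℚ) (Ground I)) :=
  IsFractionRing.injective _ _

variable (I) in
theorem q_ne_zero : q I ≠ 0 := by
  unfold q
  rw [Ne, map_eq_zero_iff _ algebraMap_ground_injective]
  exact MvPolynomial.X_ne_zero _

theorem t_ne_zero {i j : I} (e : i ⟶ j) : t e ≠ 0 := by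
  unfold t
  rw [Ne, map_eq_zero_iff _ algebraMap_ground_injective]
  exact MvPolynomial.X_ne_zero _

theorem t_injective {i j : I} : Function.Injective (t : (i ⟶ j) → Ground I) := by
  intro e f h
  have := MvPolynomial.X_injective (algebraMap_ground_injective h)
  simpa using this

theorem t_mul_t_ne_q {i j i' j' : I} (e : i ⟶ j) (f : i' ⟶ j') : t e * t f ≠ q I := by
  intro h
  unfold t q at h
  rw [← map_mul] at h
  have h1 := congrArg (MvPolynomial.eval fun o : Option (Edges I) => if o = none then (0 : ℚ) else 1)
    (algebraMap_ground_injective h)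
  simp at h1

variable (I) in
/-- The homomorphism that records the degree of a polynomial in the parameters, with `q` of degree
two and the `t_e` of degree one. -/
def gradingPoly : MvPolynomial (Option (Edges I)) ℚ →+* Polynomial (Ground I) :=
  MvPolynomial.eval₂Hom (Polynomial.C.comp
      ((algebraMap (MvPolynomial (Option (Edges I)) ℚ) (Ground I)).comp MvPolynomial.C))
    fun o => Polynomial.C (algebraMap (MvPolynomial (Option (Edges I)) ℚ) (Ground I)
      (MvPolynomial.X o)) * Polynomial.X ^ (if o = none then 2 else 1)

theorem gradingPoly_injective : Function.Injective (gradingPoly I) := by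
  have h : (Polynomial.evalRingHom 1).comp (gradingPoly I) =
      algebraMap (MvPolynomial (Option (Edges I)) ℚ) (Ground I) := by
    apply MvPolynomial.ringHom_ext
    · intro r
      simp only [gradingPoly, RingHom.comp_apply, MvPolynomial.coe_eval₂Hom, MvPolynomial.eval₂_C,
        Polynomial.coe_evalRingHom, Polynomial.eval_C]
    · intro o
      simp only [gradingPoly, RingHom.comp_apply, MvPolynomial.coe_eval₂Hom, MvPolynomial.eval₂_X,
        Polynomial.coe_evalRingHom, Polynomial.eval_C_mul, Polynomial.eval_X_pow, one_pow, mul_one]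
  have hinj := algebraMap_ground_injective (I := I)
  rw [← h, RingHom.coe_comp] at hinj
  exact hinj.of_comp

variable (I) in
/-- The extension of `gradingPoly` to the ground field. -/
def gradingHom : Ground I →+* RatFunc (Ground I) :=
  IsFractionRing.lift (A := MvPolynomial (Option (Edges I)) ℚ)
    (g := (algebraMap (Polynomial (Ground I)) (RatFunc (Ground I))).comp (gradingPoly I))
    (by
      rw [RingHom.coe_comp]
      exact (IsFractionRing.injective _ _).comp gradingPoly_injective)

/-- The degree of a nonzero element of the ground field. -/
def level (c : Ground I) : ℤ := (gradingHom I c).intDegree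

theorem level_mul {a b : Ground I} (ha : a ≠ 0) (hb : b ≠ 0) :
    level (a * b) = level a + level b := by
  unfold level
  rw [map_mul, RatFunc.intDegree_mul] <;> simpa

theorem gradingHom_X (o : Option (Edges I)) :
    gradingHom I (algebraMap (MvPolynomial (Option (Edges I)) ℚ) (Ground I) (MvPolynomial.X o)) =
      algebraMap (Polynomial (Ground I)) _ (Polynomial.C (algebraMap
        (MvPolynomial (Option (Edges I)) ℚ) (Ground I) (MvPolynomial.X o)) *
        Polynomial.X ^ (if o = none then 2 else 1)) := by
  unfold gradingHom
  rw [IsFractionRing.lift_algebraMap]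
  simp [gradingPoly]

variable (I) in
theorem level_q : level (q I) = 2 := by
  have h := q_ne_zero I
  unfold level q at *
  rw [gradingHom_X, RatFunc.intDegree_polynomial, Polynomial.natDegree_C_mul_X_pow _ _ h]
  rfl

theorem level_t {i j : I} (e : i ⟶ j) : level (t e) = 1 := by
  have h := t_ne_zero e
  unfold level t at *
  rw [gradingHom_X, RatFunc.intDegree_polynomial, Polynomial.natDegree_C_mul_X_pow _ _ h]
  rfl

theorem level_one : level (1 : Ground I) = 0 := by
  simp [level]

/-- The edges between `i` and `j`, in either direction. -/
abbrev Arr (i j : I) : Type v := (i ⟶ j) ⊕ (j ⟶ i)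

/-- The parameter of an edge between `i` and `j`, seen from `i`. -/
def coef {i j : I} : Arr i j → Ground I := Sum.elim (fun e => t e) fun e => q I / t e

theorem coef_ne_zero {i j : I} (a : Arr i j) : coef a ≠ 0 := by
  rcases a with e | e
  · exact t_ne_zero e
  · exact div_ne_zero (q_ne_zero I) (t_ne_zero e)

theorem coef_mul_coef_swap {i j : I} (a : Arr i j) : coef a * coef a.swap = q I := by
  rcases a with e | e
  · exact mul_div_cancel₀ _ (t_ne_zero e)
  · exact div_mul_cancel₀ _ (t_ne_zero e)

theorem level_coef {i j : I} (a : Arr i j) : level (coef a) = 1 := by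
  have h := congrArg level (coef_mul_coef_swap a)
  rw [level_mul (coef_ne_zero _) (coef_ne_zero _), level_q] at h
  rcases a with e | e
  · exact level_t e
  · have : level (coef (Sum.inr e : Arr i j).swap) = 1 := level_t e
    omega

theorem coef_injective {i j : I} : Function.Injective (coef : Arr i j → Ground I) := by
  intro a b h
  rcases a with e | e <;> rcases b with f | f
  · exact congrArg _ (t_injective h)
  · exact absurd ((eq_div_iff (t_ne_zero f)).1 h) (t_mul_t_ne_q _ _)
  · exact absurd ((eq_div_iff (t_ne_zero e)).1 h.symm) (t_mul_t_ne_q _ _)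
  · have h' : q I / t e = q I / t f := h
    rw [div_eq_div_iff (t_ne_zero _) (t_ne_zero _)] at h'
    exact congrArg _ (t_injective (mul_left_cancel₀ (q_ne_zero I) h').symm)

theorem q_ne_one : q I ≠ 1 := fun h => by
  have := level_q I
  rw [h, level_one] at this
  omega

theorem coef_ne_one {i j : I} (a : Arr i j) : coef a ≠ 1 := fun h => by
  have := level_coef a
  rw [h, level_one] at this
  omega

theorem coef_ne_q {i j : I} (a : Arr i j) : coef a ≠ q I := fun h => by
  have := level_coef a
  rw [h, level_q] at this
  omega

end GroundField

section Numerators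

open MvPolynomial

variable {I : Type u} [Quiver.{v} I] [Fintype I] [DecidableEq I]

/-- The wheel conditions for a polynomial. -/
def PolyWheel {n : I → ℕ} (p : MvPolynomial (Var n) (Ground I)) : Prop :=
  ∀ b m u : Var n, u.1 = b.1 → u ≠ b → m ≠ b → m ≠ u → ∀ a : Arr b.1 m.1,
    aeval (Function.update (Function.update X u (C (q I) * X b)) m (C (coef a) * X b) :
      Var n → MvPolynomial (Var n) (Ground I)) p = 0

/-- The product of `z_{ia} - z_{ib}` over `a < b`. -/
def vandermonde (n : I → ℕ) : MvPolynomial (Var n) (Ground I) :=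
  ∏ p : Var n × Var n with p.1.1 = p.2.1 ∧ (p.1.2 : ℕ) < p.2.2, (X p.1 - X p.2)

variable [∀ i j : I, Fintype (i ⟶ j)]

/-- The numerator of `ζ_{ij}(z_{ia} / z_{jb})`. -/
def num {n : I → ℕ} (x y : Var n) : MvPolynomial (Var n) (Ground I) :=
  (if x.1 = y.1 then C (q I) * X y - X x else 1) *
    ∏ a : Arr x.1 y.1, (X y - C (coef a) * X x)

/-- The numerator of the product of all `ζ_{ij}(z_{ia} / z_{jb})` with `z_{ia}` before `z_{jb}`. -/
def orderNum {n : I → ℕ} (ρ : Var n → ℤ) : MvPolynomial (Var n) (Ground I) :=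
  ∏ p : Var n × Var n with ρ p.1 < ρ p.2, num p.1 p.2

/-- The ideal spanned by the numerators of the products of all `ζ` for the orders of the variables. -/
def numIdeal (n : I → ℕ) : Ideal (MvPolynomial (Var n) (Ground I)) :=
  Ideal.span {N | ∃ ρ : Var n → ℤ, Function.Injective ρ ∧ N = orderNum ρ}

end Numerators

end

end QuiverShuffle

namespace QuiverShuffle

open MvPolynomial

/-- At a prime ideal that contains no variable, the variables fall into classes, and each has a
position, such that proportionality modulo the prime ideal is read off from these data. -/
theorem exists_positions {V F : Type*} [Field F] (P : Ideal (MvPolynomial V F)) [hP : P.IsPrime]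
    (hX : ∀ x, X x ∉ P) :
    ∃ (cls : V → V) (pos : V → F), (∀ x, pos x ≠ 0) ∧
      ∀ x y (c : F), c ≠ 0 → X x - C c * X y ∈ P → cls x = cls y ∧ pos x = c * pos y := by
  let s : Setoid V :=
    { r := fun x y => ∃ c : F, c ≠ 0 ∧ X x - C c * X y ∈ P
      iseqv :=
        { refl := fun x => ⟨1, one_ne_zero, by simp⟩
          symm := by
            rintro x y ⟨c, hc, h⟩
            refine ⟨c⁻¹, inv_ne_zero hc, ?_⟩
            have e : (X y - C c⁻¹ * X x : MvPolynomial V F) = -C c⁻¹ * (X x - C c * X y) := by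
              have : (C c⁻¹ * C c : MvPolynomial V F) = 1 := by
                rw [← C_mul, inv_mul_cancel₀ hc, C_1]
              linear_combination -(X y) * this
            rw [e]
            exact P.mul_mem_left _ h
          trans := by
            rintro x y w ⟨c, hc, h⟩ ⟨d, hd, h'⟩
            refine ⟨c * d, mul_ne_zero hc hd, ?_⟩
            have e : (X x - C (c * d) * X w : MvPolynomial V F) =
                (X x - C c * X y) + C c * (X y - C d * X w) := by rw [C_mul]; ring
            rw [e]
            exact P.add_mem h (P.mul_mem_left _ h') } }
  have hout : ∀ x : V, ∃ c : F, c ≠ 0 ∧ X x - C c * X (Quotient.mk s x).out ∈ P := fun x =>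
    Setoid.symm (Quotient.mk_out x)
  choose pos hpos hmem using hout
  refine ⟨fun x => (Quotient.mk s x).out, pos, hpos, fun x y c hc h => ?_⟩
  have hcls : Quotient.mk s x = Quotient.mk s y := Quotient.sound ⟨c, hc, h⟩
  refine ⟨congrArg Quotient.out hcls, ?_⟩
  by_contra hne
  have h1 := hmem x
  rw [hcls] at h1
  have h2 : C (pos x - c * pos y) * X (Quotient.mk s y).out ∈ P := by
    have e : (C (pos x - c * pos y) * X (Quotient.mk s y).out : MvPolynomial V F) =
        (X x - C c * X y) - (X x - C (pos x) * X (Quotient.mk s y).out) +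
          C c * (X y - C (pos y) * X (Quotient.mk s y).out) := by
      rw [C_sub, C_mul]; ring
    rw [e]
    exact P.add_mem (P.sub_mem h h1) (P.mul_mem_left _ (hmem y))
  rcases hP.mem_or_mem h2 with h3 | h3
  · exact hP.ne_top (P.eq_top_of_isUnit_mem h3 ((sub_ne_zero.2 hne).isUnit.map C))
  · exact hX _ h3

section

variable {I : Type u} [Quiver.{v} I] {n : I → ℕ}

/-- The combinatorial model of the variables near a point with given positions. -/
noncomputable def posGraph (cls : Var n → Var n) (pos : Var n → Ground I) (hpos : ∀ x, pos x ≠ 0) :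
    WheelGraph (Var n) where
  up x y := cls x = cls y ∧ ∃ a : Arr x.1 y.1, pos y = coef a * pos x
  top x w := cls x = cls w ∧ w.1 = x.1 ∧ pos w = q I * pos x
  sim a b := cls a = cls b ∧ a.1 = b.1 ∧ pos a = pos b
  lev x := level (pos x)
  ord x := x.2
  up_lev := by
    rintro x y ⟨_, a, h⟩
    rw [h, level_mul (coef_ne_zero _) (hpos x), level_coef, add_comm]
  top_lev := by
    rintro x y ⟨_, _, h⟩
    rw [h, level_mul (q_ne_zero I) (hpos x), level_q, add_comm]
  diamond := by
    rintro ⟨i, a⟩ ⟨j, b⟩ ⟨h1, h2, h3⟩ ⟨k, c⟩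
    dsimp only at h2
    subst h2
    constructor
    · rintro ⟨h4, e, h5⟩
      refine ⟨h4.symm.trans h1, e.swap, ?_⟩
      rw [h3, h5, ← coef_mul_coef_swap e]
      ring
    · rintro ⟨h4, e, h5⟩
      refine ⟨h1.trans h4.symm, e.swap, ?_⟩
      rw [h3, ← coef_mul_coef_swap e, mul_assoc] at h5
      exact (mul_left_cancel₀ (coef_ne_zero e) h5).symm
  top_sim := by
    rintro z w w' ⟨h1, h2, h3⟩ ⟨h4, h5, h6⟩
    exact ⟨h1.symm.trans h4, h2.trans h5.symm, h3.trans h6.symm⟩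
  sim_ord := by
    rintro ⟨i, a⟩ ⟨j, b⟩ ⟨_, h, _⟩ h'
    dsimp only at h
    subst h
    exact congrArg _ (Fin.ext h')

end

section Localization

variable {I : Type u} [Quiver.{v} I] [DecidableEq I] {n : I → ℕ}

variable [∀ i j : I, Fintype (i ⟶ j)]

/-- The product of the factors of `num x y` that do not belong to `P`. -/
noncomputable def coNum (P : Ideal (MvPolynomial (Var n) (Ground I))) (x y : Var n) :
    MvPolynomial (Var n) (Ground I) := by
  classical
  exact (if x.1 = y.1 ∧ C (q I) * X y - X x ∉ P then C (q I) * X y - X x else 1) *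
    ∏ a : Arr x.1 y.1, if X y - C (coef a) * X x ∉ P then X y - C (coef a) * X x else 1

theorem coNum_notMem {P : Ideal (MvPolynomial (Var n) (Ground I))} (hP : P.IsPrime)
    (x y : Var n) : coNum P x y ∉ P := by
  have h1 : (1 : MvPolynomial (Var n) (Ground I)) ∉ P := fun h =>
    hP.ne_top ((Ideal.eq_top_iff_one P).2 h)
  intro h
  rcases hP.mem_or_mem h with h | h
  · split_ifs at h with h2
    · exact h2.2 h
    · exact h1 h
  · obtain ⟨a, _, ha⟩ := (Ideal.IsPrime.prod_mem_iff (hp := hP)).1 h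
    split_ifs at ha with h3
    · exact h1 ha
    · exact h3 ha

theorem num_dvd {P : Ideal (MvPolynomial (Var n) (Ground I))} {cls : Var n → Var n}
    {pos : Var n → Ground I} (hpos : ∀ x, pos x ≠ 0)
    (hrel : ∀ x y (c : Ground I), c ≠ 0 → X x - C c * X y ∈ P → cls x = cls y ∧ pos x = c * pos y)
    (x y : Var n) (r : MvPolynomial (Var n) (Ground I))
    (hr : (posGraph cls pos hpos).Soft (fun _ => 1) x y → r = C (pos x)⁻¹ * X x - C (pos y)⁻¹ * X y)
    (hr' : ¬ (posGraph cls pos hpos).Soft (fun _ => 1) x y → r = 1) :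
    num x y ∣ coNum P x y * r := by
  classical
  have hinv : ∀ x, (C (pos x) * C (pos x)⁻¹ : MvPolynomial (Var n) (Ground I)) = 1 := fun x => by
    rw [← C_mul, mul_inv_cancel₀ (hpos x), C_1]
  unfold num coNum
  by_cases hq : x.1 = y.1 ∧ C (q I) * X y - X x ∈ P
  · obtain ⟨hxy, hq⟩ := hq
    obtain ⟨h1, h2⟩ := hrel x y (q I) (q_ne_zero I) (by
      rw [← neg_sub]; exact P.neg_mem hq)
    have hno : ∀ a : Arr x.1 y.1, X y - C (coef a) * X x ∉ P := by
      intro a ha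
      obtain ⟨_, h3⟩ := hrel y x _ (coef_ne_zero a) ha
      have e1 := congrArg level h2
      have e2 := congrArg level h3
      rw [level_mul (q_ne_zero I) (hpos y), level_q] at e1
      rw [level_mul (coef_ne_zero a) (hpos x), level_coef] at e2
      omega
    rw [hr (Or.inr ⟨h1.symm, hxy, h2⟩), if_pos hxy, if_neg (by tauto), one_mul, mul_comm]
    simp only [hno, not_false_eq_true, if_true]
    apply mul_dvd_mul_left
    refine ⟨-C (pos x)⁻¹, ?_⟩
    have h4 : (C (pos y)⁻¹ : MvPolynomial (Var n) (Ground I)) = C (q I) * C (pos x)⁻¹ := by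
      rw [← C_mul, h2, mul_inv, mul_inv_cancel_left₀ (q_ne_zero I)]
    rw [h4]
    ring
  · have hfirst : (if x.1 = y.1 then C (q I) * X y - X x else 1 :
        MvPolynomial (Var n) (Ground I)) =
        if x.1 = y.1 ∧ C (q I) * X y - X x ∉ P then C (q I) * X y - X x else 1 := by
      by_cases hxy : x.1 = y.1
      · rw [if_pos hxy, if_pos ⟨hxy, fun h => hq ⟨hxy, h⟩⟩]
      · rw [if_neg hxy, if_neg (fun h => hxy h.1)]
    rw [hfirst, mul_assoc]
    apply mul_dvd_mul_left
    by_cases ha : ∃ a : Arr x.1 y.1, X y - C (coef a) * X x ∈ P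
    · obtain ⟨a, ha⟩ := ha
      obtain ⟨h1, h2⟩ := hrel y x _ (coef_ne_zero a) ha
      have hno : ∀ b ∈ Finset.univ.erase a, X y - C (coef b) * X x ∉ P := by
        intro b hb hb'
        obtain ⟨_, h3⟩ := hrel y x _ (coef_ne_zero b) hb'
        refine Finset.ne_of_mem_erase hb (coef_injective ?_)
        exact mul_right_cancel₀ (hpos x) (h3.symm.trans h2)
      rw [hr (Or.inl ⟨⟨h1.symm, a, h2⟩, le_rfl⟩), ← Finset.mul_prod_erase _ _ (Finset.mem_univ a),
        ← Finset.mul_prod_erase _ (fun a => if X y - C (coef a) * X x ∉ P then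
          X y - C (coef a) * X x else 1) (Finset.mem_univ a), if_neg (by tauto), one_mul,
        Finset.prod_congr rfl fun b hb => if_pos (hno b hb), mul_comm]
      apply mul_dvd_mul_left
      refine ⟨-C (pos y)⁻¹, ?_⟩
      have h4 : (C (pos x)⁻¹ : MvPolynomial (Var n) (Ground I)) = C (coef a) * C (pos y)⁻¹ := by
        rw [← C_mul, h2, mul_inv, mul_inv_cancel_left₀ (coef_ne_zero a)]
      rw [h4]
      ring
    · push Not at ha
      simp only [ha, not_false_eq_true, if_true]
      exact dvd_mul_right _ _

end Localization

variable {I : Type u} [Quiver.{v} I] [Fintype I] [DecidableEq I] {n : I → ℕ}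

theorem isWheel_aeval {cls : Var n → Var n} {pos : Var n → Ground I} (hpos : ∀ x, pos x ≠ 0)
    {p : MvPolynomial (Var n) (Ground I)} (hp : PolyWheel p) :
    (posGraph cls pos hpos).IsWheel Finset.univ (fun _ => 1)
      (aeval (fun x => C (pos x) * X x) p : MvPolynomial (Var n) (Ground I)) := by
  intro x _ y _ w _ hxy hxw _ _
  have hly := (posGraph cls pos hpos).up_lev hxy
  have hlw := (posGraph cls pos hpos).top_lev hxw
  have hwx : w ≠ x := by rintro rfl; omega
  have hyx : y ≠ x := by rintro rfl; omega
  have hyw : y ≠ w := by rintro rfl; omega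
  obtain ⟨_, a, ha⟩ := hxy
  obtain ⟨_, hc, hw⟩ := hxw
  have h := hp x y w hc hwx hyx hyw a
  have h' := congrArg (aeval (fun v => C (pos v) * X (WheelGraph.collapse x y w v)) :
    MvPolynomial (Var n) (Ground I) →ₐ[Ground I] MvPolynomial (Var n) (Ground I)) h
  rw [map_zero] at h'
  rw [← h']
  rw [← AlgHom.comp_apply, ← AlgHom.comp_apply]
  congr 1
  apply algHom_ext
  intro v
  simp only [AlgHom.comp_apply, aeval_X, map_mul, MvPolynomial.rename_X, MvPolynomial.rename_C]
  by_cases hvy : v = y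
  · subst hvy
    simp [WheelGraph.collapse, ha, mul_assoc, algebraMap_eq]
  · by_cases hvw : v = w
    · subst hvw
      simp [WheelGraph.collapse, hvy, hw, mul_assoc, algebraMap_eq]
    · simp [hvy, hvw]

variable [∀ i j : I, Fintype (i ⟶ j)]

/-- Symmetric or not, a polynomial subject to the wheel conditions lies in the ideal of the shuffle
numerators, up to the Vandermonde factor and a monomial. -/
theorem exists_pow_mul_mem_numIdeal {p : MvPolynomial (Var n) (Ground I)} (hp : PolyWheel p) :
    ∃ M : ℕ, (∏ x, X x) ^ M * (vandermonde n * p) ∈ numIdeal n := by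
  classical
  by_contra hcon
  push Not at hcon
  set K : Ideal (MvPolynomial (Var n) (Ground I)) :=
    Submodule.comap (LinearMap.mulRight (MvPolynomial (Var n) (Ground I)) (vandermonde n * p))
      (numIdeal n) with hK
  have hdisj : Disjoint (K : Set (MvPolynomial (Var n) (Ground I)))
      (Submonoid.powers (∏ x : Var n, (X x : MvPolynomial (Var n) (Ground I)))) := by
    rw [Set.disjoint_left]
    rintro _ h ⟨M, rfl⟩
    exact hcon M h
  obtain ⟨P, hP, hKP, hPd⟩ := Ideal.exists_le_prime_disjoint K _ hdisj
  have hX : ∀ x, X x ∉ P := by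
    intro x hx
    refine Set.disjoint_left.1 hPd ?_ (Submonoid.mem_powers _)
    exact Ideal.mem_of_dvd P (Finset.dvd_prod_of_mem _ (Finset.mem_univ x)) hx
  obtain ⟨cls, pos, hpos, hrel⟩ := exists_positions P hX
  set G := posGraph cls pos hpos with hG
  obtain ⟨l, hl⟩ := (Finset.univ.image fun x => - G.lev x).exists_le
  have hmem := WheelGraph.vand_mul_mem_orderIdeal (F := Ground I) G _ Finset.univ (fun _ => 1) (-l)
    rfl (fun x _ => by have := hl _ (Finset.mem_image_of_mem _ (Finset.mem_univ x)); omega)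
    (fun _ _ => le_rfl) (fun _ _ _ => rfl) (fun _ _ _ => Or.inl rfl) _
    (isWheel_aeval (cls := cls) hpos hp)
  set θ : MvPolynomial (Var n) (Ground I) →ₐ[Ground I] MvPolynomial (Var n) (Ground I) :=
    aeval (fun x => C (pos x)⁻¹ * X x) with hθ
  have hθp : θ (aeval (fun x => C (pos x) * X x) p) = p := by
    rw [← AlgHom.comp_apply]
    conv_rhs => rw [← AlgHom.id_apply (R := Ground I) p]
    congr 1
    apply algHom_ext
    intro x
    have : (C (pos x) * C (pos x)⁻¹ : MvPolynomial (Var n) (Ground I)) = 1 := by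
      rw [← C_mul, mul_inv_cancel₀ (hpos x), C_1]
    simp only [AlgHom.comp_apply, aeval_X, map_mul, hθ, aeval_C, algebraMap_eq, AlgHom.coe_id, id]
    rw [← mul_assoc, this, one_mul]
  set s := ∏ e : Var n × Var n, coNum P e.1 e.2 with hs
  have hsP : s ∉ P := by
    rw [hs, Ideal.IsPrime.prod_mem_iff]
    push Not
    exact fun e _ => coNum_notMem hP _ _
  have hgen : ∀ g ∈ G.orderIdeal (Ground I) (-l) Finset.univ (fun _ => 1),
      s * θ g ∈ numIdeal n := by
    intro g hg
    refine Submodule.span_induction ?_ (by simp) ?_ ?_ hg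
    · rintro N ⟨ρ, hinj, _, rfl⟩
      refine Ideal.mem_of_dvd _ ?_ (Ideal.subset_span
        ⟨ρ, Set.injOn_univ.1 (by simpa using hinj), rfl⟩)
      have h1 : (Finset.univ.filter fun e : Var n × Var n => ρ e.1 < ρ e.2).prod (fun e => coNum P e.1 e.2) ∣ s :=
        Finset.prod_dvd_prod_of_subset _ _ _ (Finset.filter_subset _ _)
      refine dvd_trans ?_ (mul_dvd_mul_right h1 _)
      have h2 : θ (∏ e ∈ G.viol Finset.univ (fun _ => 1) ρ, (X e.1 - X e.2)) =
          ∏ e : Var n × Var n with ρ e.1 < ρ e.2,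
            if G.Soft (fun _ => 1) e.1 e.2 then θ (X e.1 - X e.2) else 1 := by
        rw [map_prod, ← Finset.prod_filter, Finset.filter_filter]
        refine Finset.prod_congr ?_ fun _ _ => rfl
        ext e
        simp [WheelGraph.viol, and_comm]
      rw [h2, ← Finset.prod_mul_distrib]
      refine Finset.prod_dvd_prod_of_dvd _ _ fun e _ => num_dvd hpos hrel _ _ _ ?_ ?_
      · intro h
        rw [if_pos h, map_sub, hθ, aeval_X, aeval_X]
      · intro h
        rw [if_neg h]
    · intro x y _ _ hx hy
      rw [map_add, mul_add]
      exact Ideal.add_mem _ hx hy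
    · intro a x _ hx
      rw [smul_eq_mul, map_mul, mul_left_comm]
      exact Ideal.mul_mem_left _ _ hx
  have hvand : θ (G.vand (Ground I) Finset.univ (fun _ => 1)) ∣ vandermonde n := by
    rw [WheelGraph.vand, map_prod, vandermonde]
    refine dvd_trans ?_ (Finset.prod_dvd_prod_of_subset _ _ _ (show
      G.pairs Finset.univ (fun _ => 1) ⊆ _ from ?_))
    · refine Finset.prod_dvd_prod_of_dvd _ _ fun e he => ?_
      obtain ⟨⟨_, _, he⟩, _⟩ := (Finset.mem_filter.1 he).2.1
      rw [map_sub, hθ, aeval_X, aeval_X, ← he]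
      refine ⟨C (pos e.1), ?_⟩
      have : (C (pos e.1) * C (pos e.1)⁻¹ : MvPolynomial (Var n) (Ground I)) = 1 := by
        rw [← C_mul, mul_inv_cancel₀ (hpos _), C_1]
      linear_combination -(X e.1 - X e.2) * this
    · intro e he
      obtain ⟨⟨⟨_, h1, _⟩, h2⟩, _⟩ := (Finset.mem_filter.1 he).2
      exact Finset.mem_filter.2 ⟨Finset.mem_univ _, h1, h2⟩
  have hfin := hgen _ hmem
  rw [map_mul, hθp] at hfin
  exact hsP (hKP (show s * (vandermonde n * p) ∈ numIdeal n from
    Ideal.mem_of_dvd _ (mul_dvd_mul_left _ (mul_dvd_mul_right hvand _)) hfin))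

end QuiverShuffle

namespace QuiverShuffle

noncomputable section

open MvPolynomial (X C aeval)

section

variable {I : Type u} [Quiver.{v} I] {n : I → ℕ}

theorem algebraMap_ratFun_injective :
    Function.Injective (algebraMap (MvPolynomial (Var n) (Ground I)) (RatFun n)) :=
  IsFractionRing.injective _ _

theorem z_ne_zero (x : Var n) : (z x : RatFun n) ≠ 0 := by
  unfold z
  rw [Ne, map_eq_zero_iff _ algebraMap_ratFun_injective]
  exact MvPolynomial.X_ne_zero _

theorem aeval_z (p : MvPolynomial (Var n) (Ground I)) :
    aeval (z : Var n → RatFun n) p = algebraMap _ (RatFun n) p := by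
  have : aeval (z : Var n → RatFun n) =
      IsScalarTower.toAlgHom (Ground I) (MvPolynomial (Var n) (Ground I)) (RatFun n) := by
    apply MvPolynomial.algHom_ext
    intro x
    simp [z]
  exact DFunLike.congr_fun this p

theorem rename_algebraMap {m : I → ℕ} (f : Var n ↪ Var m)
    (p : MvPolynomial (Var n) (Ground I)) :
    rename f (algebraMap _ (RatFun n) p) = algebraMap _ (RatFun m) (MvPolynomial.rename f p) := by
  unfold rename
  rw [IsFractionRing.liftAlgHom_apply, IsFractionRing.lift_algebraMap]
  rfl

theorem rename_z {m : I → ℕ} (f : Var n ↪ Var m) (x : Var n) : rename f (z x) = z (f x) := by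
  unfold z
  rw [rename_algebraMap, MvPolynomial.rename_X]

theorem ratFun_algHom_ext {m : I → ℕ} {f g : RatFun n →ₐ[Ground I] RatFun m}
    (h : ∀ x, f (z x) = g (z x)) : f = g := by
  have h1 : f.comp (IsScalarTower.toAlgHom (Ground I) (MvPolynomial (Var n) (Ground I)) (RatFun n)) =
      g.comp (IsScalarTower.toAlgHom (Ground I) (MvPolynomial (Var n) (Ground I)) (RatFun n)) :=
    MvPolynomial.algHom_ext h
  ext r
  obtain ⟨a, b, _, rfl⟩ := IsFractionRing.div_surjective (A := MvPolynomial (Var n) (Ground I)) r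
  rw [map_div₀, map_div₀]
  exact congrArg₂ _ (DFunLike.congr_fun h1 a) (DFunLike.congr_fun h1 b)

theorem rename_rename {m k : I → ℕ} (f : Var n ↪ Var m) (g : Var m ↪ Var k) (r : RatFun n) :
    rename g (rename f r) = rename (f.trans g) r := by
  have : (rename g).comp (rename f) = rename (f.trans g) := by
    apply ratFun_algHom_ext
    intro x
    simp [rename_z]
  exact DFunLike.congr_fun this r

section Wheel

variable [DecidableEq I]

theorem PolyWheel.aeval_eq_zero {p : MvPolynomial (Var n) (Ground I)} (hp : PolyWheel p)
    {K : Type*} [CommRing K] [Algebra (Ground I) K] {b m w : Var n} (hw : w.1 = b.1) (hwb : w ≠ b)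
    (hmb : m ≠ b) (hmw : m ≠ w) (a : Arr b.1 m.1) (f : Var n → K) (h1 : f w = q I • f b)
    (h2 : f m = coef a • f b) : aeval f p = 0 := by
  have h := congrArg (aeval f : MvPolynomial (Var n) (Ground I) →ₐ[Ground I] K)
    (hp b m w hw hwb hmb hmw a)
  rw [map_zero] at h
  rw [← h, ← AlgHom.comp_apply]
  congr 1
  apply MvPolynomial.algHom_ext
  intro x
  by_cases hxm : x = m
  · subst hxm
    simp [h2, Algebra.smul_def]
  · by_cases hxw : x = w
    · subst hxw
      simp [h1, hxm, Algebra.smul_def]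
    · simp [hxm, hxw]

theorem aeval_wheel_eq_zero_iff (p : MvPolynomial (Var n) (Ground I)) (b m w : Var n)
    (c d : Ground I) :
    aeval (Function.update (Function.update X w (C c * X b)) m (C d * X b) :
      Var n → MvPolynomial (Var n) (Ground I)) p = 0 ↔
    aeval (Function.update (Function.update z w (c • z b)) m (d • z b) : Var n → RatFun n) p = 0 := by
  rw [← map_eq_zero_iff _ (algebraMap_ratFun_injective (n := n)), ← aeval_z, ← AlgHom.comp_apply]
  have : (aeval (z : Var n → RatFun n)).comp (aeval (Function.update (Function.update X w
      (C c * X b)) m (C d * X b) : Var n → MvPolynomial (Var n) (Ground I))) =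
      aeval (Function.update (Function.update z w (c • z b)) m (d • z b) : Var n → RatFun n) := by
    apply MvPolynomial.algHom_ext
    intro x
    by_cases hxm : x = m
    · subst hxm; simp [Algebra.smul_def]
    · by_cases hxw : x = w
      · subst hxw; simp [hxm, Algebra.smul_def]
      · simp [hxm, hxw]
  rw [this]

theorem wheel_point_ne_zero (b m w : Var n) {c d : Ground I} (hc : c ≠ 0) (hd : d ≠ 0) (x : Var n) :
    (Function.update (Function.update z w (c • z b)) m (d • z b) : Var n → RatFun n) x ≠ 0 := by
  by_cases hxm : x = m
  · subst hxm; simp [hd, z_ne_zero]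
  · by_cases hxw : x = w
    · subst hxw; simp [hxm, hc, z_ne_zero]
    · simp [hxm, hxw, z_ne_zero]

end Wheel

/-- The polynomial `(∏ z) ^ M * R`, if `M` is large enough. -/
def shiftPoly (M : ℕ) [Fintype I] (R : Laurent n) : MvPolynomial (Var n) (Ground I) :=
  ∑ d ∈ R.coeff.support,
    MvPolynomial.monomial (Finsupp.equivFunOnFinite.symm fun x => (d x + M).toNat) (R.coeff d)

/-- The Laurent polynomial `(∏ z) ^ (-M) * p`. -/
def unshift (M : ℕ) (p : MvPolynomial (Var n) (Ground I)) : Laurent n :=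
  ∑ s ∈ p.support, AddMonoidAlgebra.single (fun x => (s x : ℤ) - M) (p.coeff s)

variable [Fintype I]

theorem substitute_apply {K : Type*} [Field K] [Algebra (Ground I) K] (w : Var n → K)
    (R : Laurent n) :
    substitute w R = ∑ d ∈ R.coeff.support, R.coeff d • ∏ x, w x ^ d x := by
  unfold substitute
  rw [LinearMap.comp_apply, Finsupp.linearCombination_apply]
  rfl

theorem substitute_single {K : Type*} [Field K] [Algebra (Ground I) K] (w : Var n → K)
    (d : Var n → ℤ) (c : Ground I) :
    substitute w (AddMonoidAlgebra.single d c) = c • ∏ x, w x ^ d x := by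
  unfold substitute
  rw [LinearMap.comp_apply]
  exact Finsupp.linearCombination_single _ _ _

theorem map_substitute {K L : Type*} [Field K] [Algebra (Ground I) K] [Field L]
    [Algebra (Ground I) L] (φ : K →ₐ[Ground I] L) (w : Var n → K) (R : Laurent n) :
    φ (substitute w R) = substitute (fun x => φ (w x)) R := by
  rw [substitute_apply, substitute_apply, map_sum]
  refine Finset.sum_congr rfl fun d _ => ?_
  rw [map_smul, map_prod]
  simp [map_zpow₀]

theorem exists_shift (R : Laurent n) : ∃ M : ℕ, ∀ d ∈ R.coeff.support, ∀ x, 0 ≤ d x + M := by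
  obtain ⟨M, hM⟩ := ((R.coeff.support ×ˢ Finset.univ).image
    fun e : (Var n → ℤ) × Var n => (-e.1 e.2).toNat).exists_le
  refine ⟨M, fun d hd x => ?_⟩
  have hmem : (d, x) ∈ R.coeff.support ×ˢ Finset.univ := Finset.mem_product.2 ⟨hd, Finset.mem_univ x⟩
  have := hM _ (Finset.mem_image_of_mem _ hmem)
  dsimp only at this
  omega

theorem substitute_mul_pow {K : Type*} [Field K] [Algebra (Ground I) K] {w : Var n → K}
    (hw : ∀ x, w x ≠ 0) {R : Laurent n} {M : ℕ}
    (hM : ∀ d ∈ R.coeff.support, ∀ x, 0 ≤ d x + M) :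
    substitute w R * (∏ x, w x) ^ M = aeval w (shiftPoly M R) := by
  rw [substitute_apply, shiftPoly, map_sum, Finset.sum_mul]
  refine Finset.sum_congr rfl fun d hd => ?_
  rw [MvPolynomial.aeval_monomial, Algebra.smul_def, mul_assoc, ← Finset.prod_pow,
    ← Finset.prod_mul_distrib, Finsupp.prod_fintype _ _ (by simp)]
  congr 1
  refine Finset.prod_congr rfl fun x _ => ?_
  rw [Finsupp.equivFunOnFinite_symm_apply_apply, ← zpow_natCast, ← zpow_natCast,
    Int.toNat_of_nonneg (hM d hd x), zpow_add₀ (hw x)]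

theorem substitute_unshift {K : Type*} [Field K] [Algebra (Ground I) K] {w : Var n → K}
    (hw : ∀ x, w x ≠ 0) (M : ℕ) (p : MvPolynomial (Var n) (Ground I)) :
    substitute w (unshift M p) = aeval w p * ((∏ x, w x) ^ M)⁻¹ := by
  conv_rhs => rw [← MvPolynomial.support_sum_monomial_coeff p, map_sum, Finset.sum_mul]
  rw [unshift, map_sum]
  refine Finset.sum_congr rfl fun s _ => ?_
  rw [substitute_single, MvPolynomial.aeval_monomial, Algebra.smul_def, mul_assoc,
    ← Finset.prod_pow, ← Finset.prod_inv_distrib, Finsupp.prod_fintype _ _ (by simp),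
    ← Finset.prod_mul_distrib]
  congr 1
  refine Finset.prod_congr rfl fun x _ => ?_
  rw [zpow_sub₀ (hw x), zpow_natCast, zpow_natCast, div_eq_mul_inv]

theorem toRatFun_mul_pow {R : Laurent n} {M : ℕ}
    (hM : ∀ d ∈ R.coeff.support, ∀ x, 0 ≤ d x + M) :
    toRatFun n R * (∏ x, z x) ^ M = algebraMap _ (RatFun n) (shiftPoly M R) := by
  rw [toRatFun, substitute_mul_pow z_ne_zero hM, aeval_z]

theorem toRatFun_unshift (M : ℕ) (p : MvPolynomial (Var n) (Ground I)) :
    toRatFun n (unshift M p) = algebraMap _ (RatFun n) p * ((∏ x, z x) ^ M)⁻¹ := by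
  rw [toRatFun, substitute_unshift z_ne_zero, aeval_z]

theorem prod_z_ne_zero : (∏ x : Var n, z x : RatFun n) ≠ 0 :=
  Finset.prod_ne_zero_iff.2 fun x _ => z_ne_zero x

theorem toRatFun_injective : Function.Injective (toRatFun n : Laurent n → RatFun n) := by
  classical
  rw [injective_iff_map_eq_zero]
  intro R hR
  obtain ⟨M, hM⟩ := exists_shift R
  have h := toRatFun_mul_pow hM
  rw [hR, zero_mul, eq_comm, map_eq_zero_iff _ algebraMap_ratFun_injective] at h
  rw [← AddMonoidAlgebra.coeff_eq_zero, ← Finsupp.support_eq_empty, Finset.eq_empty_iff_forall_notMem]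
  intro d hd
  have h1 := congrArg (MvPolynomial.coeff
    (Finsupp.equivFunOnFinite.symm fun x => (d x + M).toNat)) h
  rw [shiftPoly, MvPolynomial.coeff_sum, Finset.sum_eq_single d, MvPolynomial.coeff_monomial,
    if_pos rfl, MvPolynomial.coeff_zero] at h1
  · exact Finsupp.mem_support_iff.1 hd h1
  · intro d' hd' hne
    rw [MvPolynomial.coeff_monomial, if_neg]
    intro e
    refine hne (funext fun x => ?_)
    have h2 := DFunLike.congr_fun e x
    simp only [Finsupp.equivFunOnFinite_symm_apply_apply] at h2
    have := hM d hd x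
    have := hM d' hd' x
    omega
  · exact fun h => absurd hd h

theorem rename_toRatFun {m : I → ℕ} (f : Var n ↪ Var m) (R : Laurent n) :
    rename f (toRatFun n R) = substitute (fun x => (z (f x) : RatFun m)) R := by
  rw [toRatFun, map_substitute]
  simp only [rename_z]

/-- Symmetric Laurent polynomials are those that are invariant as rational functions. -/
theorem isSymmetric_iff (R : Laurent n) :
    IsSymmetric R ↔ ∀ π, rename (permVar π) (toRatFun n R) = toRatFun n R := by
  have key : ∀ π : ∀ i, Equiv.Perm (Fin (n i)), rename (permVar π) (toRatFun n R) =
      toRatFun n (AddMonoidAlgebra.ofCoeff (R.coeff.mapDomain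
        fun d (x : Var n) => d ⟨x.1, (π x.1).symm x.2⟩)) := by
    intro π
    rw [rename_toRatFun, substitute, LinearMap.comp_apply, toRatFun, substitute,
      LinearMap.comp_apply]
    change Finsupp.linearCombination _ _ R.coeff = Finsupp.linearCombination _ _ (R.coeff.mapDomain _)
    rw [Finsupp.linearCombination_mapDomain]
    congr 2
    ext d
    refine Fintype.prod_equiv (Equiv.sigmaCongrRight π) _ _ fun x => ?_
    change z _ ^ d x = z _ ^ d ⟨x.1, (π x.1).symm (π x.1 x.2)⟩
    rw [Equiv.symm_apply_apply]
    rfl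
  have hinj : ∀ π : ∀ i, Equiv.Perm (Fin (n i)), Function.Injective
      fun (d : Var n → ℤ) (x : Var n) => d ⟨x.1, (π x.1).symm x.2⟩ := by
    intro π d d' h
    funext x
    have := congrFun h ⟨x.1, π x.1 x.2⟩
    simpa using this
  have hmap : ∀ (π : ∀ i, Equiv.Perm (Fin (n i))) (d : Var n → ℤ),
      (R.coeff.mapDomain fun d (x : Var n) => d ⟨x.1, (π x.1).symm x.2⟩) d =
        R.coeff fun x => d ⟨x.1, π x.1 x.2⟩ := by
    intro π d
    have hd : d = fun x : Var n => (fun y : Var n => d ⟨y.1, π y.1 y.2⟩)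
        ⟨x.1, (π x.1).symm x.2⟩ := by
      funext x; simp
    exact (congrArg _ hd).trans (Finsupp.mapDomain_apply (hinj π) R.coeff fun y : Var n => d ⟨y.1, π y.1 y.2⟩)
  constructor
  · intro h π
    rw [key]
    congr 1
    apply AddMonoidAlgebra.coeff_injective
    ext d
    exact (hmap π d).trans (h π d)
  · intro h π d
    have h1 := h π
    rw [key] at h1
    exact (hmap π d).symm.trans (congrArg (fun S : Laurent n => S.coeff d) (toRatFun_injective h1))

variable [DecidableEq I]

theorem wheel_iff (R : Laurent n) (p : MvPolynomial (Var n) (Ground I))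
    (h : ∀ w : Var n → RatFun n, (∀ x, w x ≠ 0) → (substitute w R = 0 ↔ aeval w p = 0)) :
    Wheel R ↔ PolyWheel p := by
  constructor
  · rintro ⟨h1, h2⟩ ⟨i, c⟩ ⟨j, b⟩ ⟨k, a⟩ hk hab hmb hma e
    dsimp only at hk
    subst hk
    rw [aeval_wheel_eq_zero_iff, ← h _ (wheel_point_ne_zero _ _ _ (q_ne_zero I) (coef_ne_zero _))]
    rcases e with e | e
    · exact h1 _ _ e a c b hab hma.symm hmb
    · exact h2 _ _ e a c b hab hma.symm hmb
  · intro hp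
    constructor
    · intro i j e a c b hac hab hbc
      rw [h _ (wheel_point_ne_zero _ _ _ (q_ne_zero I) (t_ne_zero e)),
        ← aeval_wheel_eq_zero_iff]
      exact hp ⟨i, c⟩ ⟨j, b⟩ ⟨i, a⟩ rfl hac hbc hab.symm (Sum.inl e)
    · intro i j e a c b hac hab hbc
      rw [h _ (wheel_point_ne_zero _ _ _ (q_ne_zero I) (div_ne_zero (q_ne_zero I) (t_ne_zero e))),
        ← aeval_wheel_eq_zero_iff]
      exact hp ⟨j, c⟩ ⟨i, b⟩ ⟨j, a⟩ rfl hac hbc hab.symm (Sum.inr e)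

theorem Wheel.polyWheel {R : Laurent n} (h : Wheel R) {M : ℕ}
    (hM : ∀ d ∈ R.coeff.support, ∀ x, 0 ≤ d x + M) : PolyWheel (shiftPoly M R) := by
  refine (wheel_iff R _ fun w hw => ?_).1 h
  rw [← substitute_mul_pow hw hM, mul_eq_zero, or_iff_left]
  exact pow_ne_zero _ (Finset.prod_ne_zero_iff.2 fun x _ => hw x)

theorem PolyWheel.wheel {p : MvPolynomial (Var n) (Ground I)} (h : PolyWheel p) (M : ℕ) :
    Wheel (unshift M p) := by
  refine (wheel_iff _ p fun w hw => ?_).2 h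
  rw [substitute_unshift hw, mul_eq_zero, or_iff_left]
  exact inv_ne_zero (pow_ne_zero _ (Finset.prod_ne_zero_iff.2 fun x _ => hw x))

end

instance (I : Type u) [Quiver.{v} I] : CharZero (Ground I) :=
  charZero_of_injective_algebraMap (algebraMap_ground_injective (I := I))

section Symmetrization

variable {I : Type u}

/-- The variables of degree `n + n'` are those of degree `n` and those of degree `n'`. -/
def varSum (n n' : I → ℕ) : Var n ⊕ Var n' ≃ Var (n + n') :=
  (Equiv.sigmaSumDistrib (fun i => Fin (n i)) fun i => Fin (n' i)).symm.trans
    (Equiv.sigmaCongrRight fun _ => finSumFinEquiv)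

theorem var_cases {n n' : I → ℕ} (x : Var (n + n')) :
    (∃ y, x = leftVar n n' y) ∨ ∃ y, x = rightVar n n' y := by
  obtain ⟨y, rfl⟩ := (varSum n n').surjective x
  rcases y with y | y
  · exact Or.inl ⟨y, rfl⟩
  · exact Or.inr ⟨y, rfl⟩

theorem leftVar_ne_rightVar {n n' : I → ℕ} (x : Var n) (y : Var n') :
    leftVar n n' x ≠ rightVar n n' y := fun h =>
  Sum.inl_ne_inr ((varSum n n').injective (a₁ := Sum.inl x) (a₂ := Sum.inr y) h)

theorem permVar_mul {n : I → ℕ} (π σ : ∀ i, Equiv.Perm (Fin (n i))) :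
    permVar (π * σ) = (permVar σ).trans (permVar π) := rfl

/-- Extension of permutations of the last variables by the identity. -/
def extendPerm {n n' : I → ℕ} (π : ∀ i, Equiv.Perm (Fin (n' i))) :
    ∀ i, Equiv.Perm (Fin ((n + n') i)) :=
  fun i => finSumFinEquiv.permCongr (Equiv.Perm.sumCongr (1 : Equiv.Perm (Fin (n i))) (π i))

theorem permVar_extendPerm_left {n n' : I → ℕ} (π : ∀ i, Equiv.Perm (Fin (n' i))) (x : Var n) :
    permVar (extendPerm (n := n) π) (leftVar n n' x) = leftVar n n' x := by
  obtain ⟨i, a⟩ := x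
  refine congrArg (Sigma.mk i) ?_
  change finSumFinEquiv ((Equiv.Perm.sumCongr 1 (π i)) (finSumFinEquiv.symm (Fin.castAdd _ a))) = _
  rw [finSumFinEquiv_symm_apply_castAdd]
  rfl

theorem permVar_extendPerm_right {n n' : I → ℕ} (π : ∀ i, Equiv.Perm (Fin (n' i))) (x : Var n') :
    permVar (extendPerm (n := n) π) (rightVar n n' x) = rightVar n n' (permVar π x) := by
  obtain ⟨i, a⟩ := x
  refine congrArg (Sigma.mk i) ?_
  change finSumFinEquiv ((Equiv.Perm.sumCongr 1 (π i)) (finSumFinEquiv.symm (Fin.natAdd _ a))) = _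
  rw [finSumFinEquiv_symm_apply_natAdd]
  rfl

variable [Fintype I]

theorem prod_var_add {n n' : I → ℕ} {M : Type*} [CommMonoid M] (f : Var (n + n') → M) :
    ∏ x, f x = (∏ x, f (leftVar n n' x)) * ∏ y, f (rightVar n n' y) := by
  rw [← (varSum n n').prod_comp, Fintype.prod_sum_type]
  rfl

variable [Quiver.{v} I]

/-- A Laurent monomial as a rational function. -/
def mono {n : I → ℕ} (d : Var n → ℤ) : RatFun n := ∏ x, z x ^ d x

theorem toRatFun_single {n : I → ℕ} (d : Var n → ℤ) (c : Ground I) :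
    toRatFun n (AddMonoidAlgebra.single d c) = c • mono d := substitute_single _ _ _

theorem toRatFun_mem_span {n : I → ℕ} (R : Laurent n) :
    toRatFun n R ∈ Submodule.span (Ground I) (Set.range (mono (n := n))) := by
  rw [toRatFun, substitute_apply]
  exact Submodule.sum_mem _ fun d _ => Submodule.smul_mem _ _ (Submodule.subset_span ⟨d, rfl⟩)

theorem rename_permVar_mono {n : I → ℕ} (π : ∀ i, Equiv.Perm (Fin (n i))) (d : Var n → ℤ) :
    rename (permVar π) (mono d) = mono fun x => d ((Equiv.sigmaCongrRight π).symm x) := by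
  unfold mono
  rw [map_prod]
  refine Fintype.prod_equiv (Equiv.sigmaCongrRight π) _ _ fun x => ?_
  rw [map_zpow₀, rename_z]
  change z _ ^ d x = z _ ^ d ((Equiv.sigmaCongrRight π).symm (Equiv.sigmaCongrRight π x))
  rw [Equiv.symm_apply_apply]
  rfl

theorem mono_add_eq {n n' : I → ℕ} (d : Var (n + n') → ℤ) :
    mono d = rename (leftVar n n') (mono fun x => d (leftVar n n' x)) *
      rename (rightVar n n') (mono fun x => d (rightVar n n' x)) := by
  unfold mono
  rw [prod_var_add, map_prod, map_prod]
  simp only [map_zpow₀, rename_z]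

theorem mono_mul_mono {n : I → ℕ} (d d' : Var n → ℤ) : mono d * mono d' = (mono (d + d') : RatFun n) := by
  rw [mono, mono, mono, ← Finset.prod_mul_distrib]
  exact Finset.prod_congr rfl fun x _ => (zpow_add₀ (z_ne_zero x) _ _).symm

variable [DecidableEq I]

theorem sym_apply {n : I → ℕ} (r : RatFun n) :
    sym n r = ∑ π : (∀ i, Equiv.Perm (Fin (n i))), rename (permVar π) r := by
  simp [sym]

theorem sym_rename {n : I → ℕ} (σ : ∀ i, Equiv.Perm (Fin (n i))) (r : RatFun n) :
    sym n (rename (permVar σ) r) = sym n r := by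
  rw [sym_apply, sym_apply]
  refine Fintype.sum_equiv (Equiv.mulRight σ) _ _ fun π => ?_
  rw [rename_rename, ← permVar_mul]
  rfl

theorem rename_sym {n : I → ℕ} (σ : ∀ i, Equiv.Perm (Fin (n i))) (r : RatFun n) :
    rename (permVar σ) (sym n r) = sym n r := by
  rw [sym_apply, map_sum]
  refine Fintype.sum_equiv (Equiv.mulLeft σ) _ _ fun π => ?_
  rw [rename_rename, ← permVar_mul]
  rfl

end Symmetrization

section Zeta

variable {I : Type u} [Quiver.{v} I] [DecidableEq I] [∀ i j : I, Fintype (i ⟶ j)]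

theorem map_zeta {K L : Type*} [Field K] [Algebra (Ground I) K] [Field L] [Algebra (Ground I) L]
    (φ : K →ₐ[Ground I] L) (i j : I) (x : K) : φ (zeta i j x) = zeta i j (φ x) := by
  unfold zeta
  rw [map_mul, map_mul, map_prod, map_prod, apply_ite φ]
  simp

/-- The denominator of `ζ_{ij}(z_{ia} / z_{jb})`. -/
def den {n : I → ℕ} (x y : Var n) : MvPolynomial (Var n) (Ground I) :=
  (if x.1 = y.1 then C (q I) * (X y - X x) else 1) * X y ^ Fintype.card (Arr x.1 y.1)

theorem zeta_mul_den {n : I → ℕ} {x y : Var n} (h : x ≠ y) :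
    zeta x.1 y.1 (z x / z y) * algebraMap _ (RatFun n) (den x y) =
      algebraMap _ (RatFun n) (num x y) := by
  have hC : ∀ c : Ground I, algebraMap (MvPolynomial (Var n) (Ground I)) (RatFun n) (C c) =
      algebraMap (Ground I) (RatFun n) c := fun c =>
    (IsScalarTower.algebraMap_apply (Ground I) (MvPolynomial (Var n) (Ground I)) (RatFun n) c).symm
  have hX : ∀ x, algebraMap (MvPolynomial (Var n) (Ground I)) (RatFun n) (X x) = z x := fun _ => rfl
  have hy := z_ne_zero y
  have h1 : (if x.1 = y.1 then (1 - (q I)⁻¹ • (z x / z y)) / (1 - z x / z y) else 1 : RatFun n) *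
      algebraMap _ (RatFun n) (if x.1 = y.1 then C (q I) * (X y - X x) else 1) =
      algebraMap _ (RatFun n) (if x.1 = y.1 then C (q I) * X y - X x else 1) := by
    split_ifs
    · have hq : algebraMap (Ground I) (RatFun n) (q I) ≠ 0 := by simpa using q_ne_zero I
      have hxy : z y - z x ≠ 0 := by
        intro e
        rw [← hX, ← hX, ← map_sub, map_eq_zero_iff _ algebraMap_ratFun_injective] at e
        exact WheelGraph.X_sub_X_ne_zero h.symm e
      have hxy' : (1 - z x / z y : RatFun n) ≠ 0 := by
        rw [one_sub_div hy]
        exact div_ne_zero hxy hy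
      simp only [map_mul, map_sub, hC, hX, Algebra.smul_def, map_inv₀]
      field_simp
    · simp
  have h2 : ((∏ e : x.1 ⟶ y.1, (1 - t e • (z x / z y))) *
      ∏ e : y.1 ⟶ x.1, (1 - (q I / t e) • (z x / z y)) : RatFun n) *
      algebraMap (MvPolynomial (Var n) (Ground I)) (RatFun n) (X y ^ Fintype.card (Arr x.1 y.1)) =
      algebraMap (MvPolynomial (Var n) (Ground I)) (RatFun n) (∏ a : Arr x.1 y.1, (X y - C (coef a) * X x)) := by
    have h3 : ((∏ e : x.1 ⟶ y.1, (1 - t e • (z x / z y))) *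
      ∏ e : y.1 ⟶ x.1, (1 - (q I / t e) • (z x / z y)) : RatFun n) =
      ∏ a : Arr x.1 y.1, (1 - coef a • (z x / z y)) := by
      rw [Fintype.prod_sum_type]
      rfl
    rw [h3, map_pow, map_prod, hX, Fintype.card, ← Finset.prod_const, ← Finset.prod_mul_distrib]
    refine Finset.prod_congr rfl fun a _ => ?_
    simp only [map_mul, map_sub, hC, hX, Algebra.smul_def]
    field_simp
  rw [den, num, zeta, map_mul, map_mul, ← h1, ← h2]
  ring

variable [Fintype I]

/-- The product of `ζ_{ij}(z_{ia} / z_{jb})` over all pairs with `z_{ia}` before `z_{jb}`. -/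
def orderZeta {n : I → ℕ} (ρ : Var n → ℤ) : RatFun n :=
  ∏ p : Var n × Var n with ρ p.1 < ρ p.2, zeta p.1.1 p.2.1 (z p.1 / z p.2)

theorem orderZeta_mul_den {n : I → ℕ} (ρ : Var n → ℤ) :
    orderZeta ρ * algebraMap _ (RatFun n) (∏ p : Var n × Var n with ρ p.1 < ρ p.2, den p.1 p.2) =
      algebraMap _ (RatFun n) (orderNum ρ) := by
  rw [orderZeta, orderNum, map_prod, map_prod, ← Finset.prod_mul_distrib]
  refine Finset.prod_congr rfl fun p hp => zeta_mul_den ?_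
  intro e
  simp [e] at hp

theorem orderZeta_eq {n : I → ℕ} (ρ : Var n → ℤ) :
    orderZeta ρ = ∏ x, ∏ y, if ρ x < ρ y then zeta x.1 y.1 (z x / z y : RatFun n) else 1 := by
  rw [orderZeta, Finset.prod_filter, Fintype.prod_prod_type]

theorem rename_permVar_orderZeta {n : I → ℕ} (π : ∀ i, Equiv.Perm (Fin (n i))) (ρ : Var n → ℤ) :
    rename (permVar π) (orderZeta ρ) =
      orderZeta fun x => ρ ((Equiv.sigmaCongrRight π).symm x) := by
  rw [orderZeta_eq, orderZeta_eq, map_prod]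
  refine Fintype.prod_equiv (Equiv.sigmaCongrRight π) _ _ fun x => ?_
  rw [map_prod]
  refine Fintype.prod_equiv (Equiv.sigmaCongrRight π) _ _ fun y => ?_
  rw [Equiv.symm_apply_apply, Equiv.symm_apply_apply]
  split_ifs
  · rw [map_zeta, map_div₀, rename_z, rename_z]
    rfl
  · exact map_one _

theorem rename_extendPerm_kernel {n n' : I → ℕ} (π : ∀ i, Equiv.Perm (Fin (n' i))) :
    rename (permVar (extendPerm (n := n) π)) (kernel n n') = kernel n n' := by
  unfold kernel
  rw [map_prod]
  refine Finset.prod_congr rfl fun x _ => ?_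
  rw [map_prod]
  refine Fintype.prod_equiv (Equiv.sigmaCongrRight π) _ _ fun y => ?_
  rw [map_zeta, map_div₀, rename_z, rename_z, permVar_extendPerm_left, permVar_extendPerm_right]
  rfl

end Zeta

section Spherical

variable {I : Type u}

theorem var_single_eq [DecidableEq I] {i : I} (x : Var (Pi.single i 1 : I → ℕ)) :
    x = ⟨i, ⟨0, by simp⟩⟩ := by
  obtain ⟨j, c⟩ := x
  by_cases h : j = i
  · subst h
    have hc := c.2
    simp only [Pi.single_eq_same] at hc
    exact congrArg (Sigma.mk j) (Fin.ext (by change (c : ℕ) = 0; omega))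
  · have hc := c.2
    simp [h] at hc

instance [DecidableEq I] (i : I) : Subsingleton (Var (Pi.single i 1 : I → ℕ)) :=
  ⟨fun x y => (var_single_eq x).trans (var_single_eq y).symm⟩

variable [Quiver.{v} I] [Fintype I] [DecidableEq I]

theorem mem_shufflePiece_single {i : I} (R : Laurent (Pi.single i 1 : I → ℕ)) :
    R ∈ shufflePiece (Pi.single i 1 : I → ℕ) :=
  ⟨fun _ d => congrArg _ (funext fun _ => congrArg d (Subsingleton.elim _ _)),
    fun _ _ _ _ _ _ h => absurd (Subsingleton.elim _ _) h,
    fun _ _ _ _ _ _ h => absurd (Subsingleton.elim _ _) h⟩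

variable [∀ i j : I, Fintype (i ⟶ j)]

theorem mul_inDegree {n m : I → ℕ} (a : RatFun n) (b : RatFun m) :
    mul I (inDegree I n a) (inDegree I m b) = inDegree I (n + m) (shuffle n m a b) := by
  unfold mul
  rw [inDegree, DirectSum.toModule_lof, LinearMap.flip_apply, inDegree, DirectSum.toModule_lof]
  rfl

theorem one_mem_sphericalAlgebra : one I ∈ sphericalAlgebra I :=
  Submodule.mem_sInf.2 fun _ hA => hA.1

theorem generators_subset_sphericalAlgebra : generators I ⊆ sphericalAlgebra I :=
  fun _ hF => Submodule.mem_sInf.2 fun _ hA => hA.2.1 hF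

theorem mul_mem_sphericalAlgebra {F G : Total I} (hF : F ∈ sphericalAlgebra I)
    (hG : G ∈ sphericalAlgebra I) : mul I F G ∈ sphericalAlgebra I :=
  Submodule.mem_sInf.2 fun A hA =>
    hA.2.2 F (Submodule.mem_sInf.1 hF A hA) G (Submodule.mem_sInf.1 hG A hA)

theorem shuffle_apply {n n' : I → ℕ} (R : RatFun n) (R' : RatFun n') :
    shuffle n n' R R' = (((∏ i, (n i).factorial) * ∏ i, (n' i).factorial : ℕ) : Ground I)⁻¹ •
      sym (n + n') (rename (leftVar n n') R * rename (rightVar n n') R' * kernel n n') := by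
  rw [shuffle, LinearMap.mk₂_apply, map_smul]

theorem sym_mul_rename_sym {n n' : I → ℕ} (R : RatFun n) (R' : RatFun n') :
    sym (n + n') (rename (leftVar n n') R * rename (rightVar n n') (sym n' R') * kernel n n') =
      Fintype.card (∀ i, Equiv.Perm (Fin (n' i))) •
        sym (n + n') (rename (leftVar n n') R * rename (rightVar n n') R' * kernel n n') := by
  rw [sym_apply (n := n'), map_sum, Finset.mul_sum, Finset.sum_mul, map_sum, ← Finset.card_univ,
    ← Finset.sum_const]
  refine Finset.sum_congr rfl fun π _ => ?_
  conv_rhs => rw [← sym_rename (extendPerm (n := n) π)]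
  rw [map_mul (rename _), map_mul (rename _), rename_extendPerm_kernel, rename_rename,
    rename_rename, rename_rename]
  congr 5
  · ext1 x
    exact (permVar_extendPerm_left π x).symm
  · ext1 x
    exact (permVar_extendPerm_right π x).symm

theorem orderZeta_eq_mul_kernel {n n' : I → ℕ} (ρ : Var (n + n') → ℤ)
    (h : ∀ x y, ρ (leftVar n n' x) < ρ (rightVar n n' y)) :
    orderZeta ρ = rename (leftVar n n') (orderZeta fun x => ρ (leftVar n n' x)) *
      rename (rightVar n n') (orderZeta fun x => ρ (rightVar n n' x)) * kernel n n' := by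
  have h1 : ∀ {m : I → ℕ} (f : Var m ↪ Var (n + n')) (hf : ∀ x, (f x).1 = x.1),
      rename f (orderZeta fun x => ρ (f x)) = ∏ x, ∏ y, if ρ (f x) < ρ (f y) then
        zeta (f x).1 (f y).1 (z (f x) / z (f y) : RatFun (n + n')) else 1 := by
    intro m f hf
    rw [orderZeta_eq, map_prod]
    refine Finset.prod_congr rfl fun x _ => ?_
    rw [map_prod]
    refine Finset.prod_congr rfl fun y _ => ?_
    split_ifs
    · rw [map_zeta, map_div₀, rename_z, rename_z, hf, hf]
    · exact map_one _
  rw [h1 _ fun _ => rfl, h1 _ fun _ => rfl, orderZeta_eq, prod_var_add, kernel]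
  simp only [prod_var_add, Finset.prod_mul_distrib, h, (h _ _).not_gt, if_true, if_false,
    Finset.prod_const_one, one_mul]
  rw [mul_right_comm]
  rfl

theorem sym_mono_mul_orderZeta_of_lt {n n' : I → ℕ} (d : Var (n + n') → ℤ) (ρ : Var (n + n') → ℤ)
    (h : ∀ x y, ρ (leftVar n n' x) < ρ (rightVar n n' y)) :
    ∃ c : Ground I, sym (n + n') (mono d * orderZeta ρ) = c • shuffle n n'
      (mono (fun x => d (leftVar n n' x)) * orderZeta fun x => ρ (leftVar n n' x))
      (sym n' (mono (fun x => d (rightVar n n' x)) * orderZeta fun x => ρ (rightVar n n' x))) := by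
  refine ⟨(Fintype.card (∀ i, Equiv.Perm (Fin (n' i))) : Ground I)⁻¹ *
    (((∏ i, (n i).factorial) * ∏ i, (n' i).factorial : ℕ) : Ground I), ?_⟩
  have h1 : (((∏ i, (n i).factorial) * ∏ i, (n' i).factorial : ℕ) : Ground I) ≠ 0 := by
    rw [Nat.cast_ne_zero]
    exact mul_ne_zero (Finset.prod_ne_zero_iff.2 fun i _ => Nat.factorial_ne_zero _)
      (Finset.prod_ne_zero_iff.2 fun i _ => Nat.factorial_ne_zero _)
  have h2 : (Fintype.card (∀ i, Equiv.Perm (Fin (n' i))) : Ground I) ≠ 0 :=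
    Nat.cast_ne_zero.2 Fintype.card_ne_zero
  rw [shuffle_apply, sym_mul_rename_sym, mul_smul, smul_inv_smul₀ h1, ← Nat.cast_smul_eq_nsmul
    (Ground I), inv_smul_smul₀ h2, mono_add_eq, orderZeta_eq_mul_kernel ρ h, map_mul (rename _),
    map_mul (rename _)]
  congr 1
  ring

theorem inDegree_mono_single_mem {i : I} (d : Var (Pi.single i 1 : I → ℕ) → ℤ) :
    inDegree I (Pi.single i 1) (mono d) ∈ sphericalAlgebra I := by
  refine generators_subset_sphericalAlgebra
    ⟨i, AddMonoidAlgebra.single d 1, mem_shufflePiece_single _, ?_⟩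
  rw [toRatFun_single, one_smul]

theorem inDegree_sym_mono_mul_orderZeta_mem (k : ℕ) : ∀ (n : I → ℕ), ∑ i, n i = k →
    ∀ (d ρ : Var n → ℤ), Function.Injective ρ →
      inDegree I n (sym n (mono d * orderZeta ρ)) ∈ sphericalAlgebra I := by
  induction k with
  | zero =>
    intro n hn d ρ _
    obtain rfl : n = 0 := by
      funext i
      exact Finset.sum_eq_zero_iff.1 hn i (Finset.mem_univ i)
    have : IsEmpty (Var (0 : I → ℕ)) := ⟨fun x => x.2.elim0⟩
    have h1 : mono d * orderZeta ρ = (1 : RatFun (0 : I → ℕ)) := by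
      rw [mono, orderZeta_eq, Fintype.prod_empty, Fintype.prod_empty, one_mul]
    rw [h1, sym_apply]
    simp only [map_one, Finset.sum_const, map_nsmul]
    exact Submodule.smul_of_tower_mem _ _ one_mem_sphericalAlgebra
  | succ k ih =>
    intro n hn d ρ hρ
    have : Nonempty (Var n) := by
      obtain ⟨i, hi⟩ : ∃ i, n i ≠ 0 := by
        by_contra! h
        simp [h] at hn
      exact ⟨⟨i, ⟨0, Nat.pos_of_ne_zero hi⟩⟩⟩
    obtain ⟨⟨i, a⟩, ha⟩ := Finite.exists_min ρ
    obtain ⟨n', rfl⟩ : ∃ n' : I → ℕ, n = (Pi.single i 1 : I → ℕ) + n' := by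
      refine ⟨n - Pi.single i 1, funext fun j => ?_⟩
      change n j = (Pi.single i 1 : I → ℕ) j + (n j - (Pi.single i 1 : I → ℕ) j)
      by_cases hj : j = i
      · subst hj
        have := a.2
        rw [Pi.single_eq_same]
        omega
      · rw [Pi.single_eq_of_ne hj]
        omega
    set b : Fin ((Pi.single i 1 + n' : I → ℕ) i) :=
      (leftVar (Pi.single i 1) n' ⟨i, ⟨0, by simp⟩⟩).2 with hb
    set π : ∀ j, Equiv.Perm (Fin ((Pi.single i 1 + n' : I → ℕ) j)) :=
      Function.update 1 i (Equiv.swap a b)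
    have hx : (Equiv.sigmaCongrRight π).symm (⟨i, b⟩ : Var _) = ⟨i, a⟩ := by
      rw [Equiv.symm_apply_eq]
      refine congrArg (Sigma.mk i) ?_
      simp [π]
    rw [← sym_rename π, map_mul, rename_permVar_mono, rename_permVar_orderZeta]
    set ρ' : Var (Pi.single i 1 + n') → ℤ := fun x => ρ ((Equiv.sigmaCongrRight π).symm x)
    have hρ' : Function.Injective ρ' := hρ.comp (Equiv.injective _)
    have hlt : ∀ x y, ρ' (leftVar (Pi.single i 1) n' x) < ρ' (rightVar (Pi.single i 1) n' y) := by
      intro x y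
      refine lt_of_le_of_ne ?_ (hρ'.ne (leftVar_ne_rightVar x y))
      rw [var_single_eq x]
      refine le_trans (le_of_eq ?_) (ha _)
      exact congrArg ρ hx
    obtain ⟨c, hc⟩ := sym_mono_mul_orderZeta_of_lt
      (fun x => d ((Equiv.sigmaCongrRight π).symm x)) ρ' hlt
    rw [hc, map_smul, ← mul_inDegree]
    refine Submodule.smul_mem _ _ (mul_mem_sphericalAlgebra ?_ (ih _ ?_ _ _ ?_))
    · have : (orderZeta fun x => ρ' (leftVar (Pi.single i 1) n' x)) = 1 := by
        rw [orderZeta_eq]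
        refine Finset.prod_eq_one fun x _ => Finset.prod_eq_one fun y _ => if_neg ?_
        rw [Subsingleton.elim x y]
        exact lt_irrefl _
      rw [this, mul_one]
      exact inDegree_mono_single_mem _
    · have h1 : ∑ j, (Pi.single i 1 : I → ℕ) j = 1 := by simp
      simp only [Pi.add_apply, Finset.sum_add_distrib, h1] at hn
      omega
    · exact hρ'.comp (rightVar _ _).injective

end Spherical

section VandermondeDvd

variable {I : Type u}

theorem var_ne_of_lt {n : I → ℕ} {x y : Var n} (h : (x.2 : ℕ) < y.2) : x ≠ y := by
  rintro rfl
  exact lt_irrefl _ h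

theorem collapse_ne [DecidableEq I] {n : I → ℕ} {a b c d : Var n} (hab : (a.2 : ℕ) < b.2)
    (hcd : (c.2 : ℕ) < d.2) (hne : (a, b) ≠ (c, d)) :
    Function.update id a b c ≠ Function.update id a b d := by
  by_cases hc : c = a
  · subst hc
    rw [Function.update_self, Function.update_of_ne (var_ne_of_lt hcd).symm]
    rintro rfl
    exact hne rfl
  · rw [Function.update_of_ne hc]
    by_cases hd : d = a
    · subst hd
      rw [Function.update_self]
      rintro rfl
      exact lt_asymm hab hcd
    · rw [Function.update_of_ne hd]
      exact var_ne_of_lt hcd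

variable [Quiver.{v} I] [Fintype I] [DecidableEq I]

theorem vandermonde_dvd {n : I → ℕ} {f : MvPolynomial (Var n) (Ground I)}
    (h : ∀ x y : Var n, x.1 = y.1 → (x.2 : ℕ) < y.2 →
      MvPolynomial.rename (Function.update id x y) f = 0) : vandermonde n ∣ f := by
  refine WheelGraph.prod_X_sub_X_dvd _ f (fun p hp => ?_) fun p hp p' hp' hne => ?_
  · simp only [Finset.mem_filter, Finset.mem_univ, true_and] at hp
    exact h _ _ hp.1 hp.2
  · simp only [Finset.mem_filter, Finset.mem_univ, true_and] at hp hp'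
    exact collapse_ne hp.2 hp'.2 hne

theorem vandermonde_ne_zero (n : I → ℕ) : vandermonde n ≠ 0 := by
  refine Finset.prod_ne_zero_iff.2 fun p hp => WheelGraph.X_sub_X_ne_zero ?_
  simp only [Finset.mem_filter, Finset.mem_univ, true_and] at hp
  exact var_ne_of_lt hp.2

theorem algebraMap_vandermonde_ne_zero (n : I → ℕ) :
    algebraMap _ (RatFun n) (vandermonde n) ≠ 0 := by
  rw [Ne, map_eq_zero_iff _ algebraMap_ratFun_injective]
  exact vandermonde_ne_zero n

end VandermondeDvd

section OrderSpan

variable {I : Type u} [Quiver.{v} I] [Fintype I] [DecidableEq I] [∀ i j : I, Fintype (i ⟶ j)]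
  {n : I → ℕ}

theorem vandermonde_dvd_prod_den {ρ : Var n → ℤ} (hρ : Function.Injective ρ) :
    vandermonde n ∣ ∏ p : Var n × Var n with ρ p.1 < ρ p.2, den p.1 p.2 := by
  refine vandermonde_dvd fun x y hxy hlt => ?_
  have hne := var_ne_of_lt hlt
  rw [map_prod]
  have h0 : ∀ a b : Var n, a.1 = b.1 → Function.update id x y a = Function.update id x y b →
      MvPolynomial.rename (Function.update id x y) (den a b) = 0 := by
    intro a b hab h
    rw [den, if_pos hab, map_mul, map_mul, map_sub, MvPolynomial.rename_X, MvPolynomial.rename_X,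
      h, sub_self, mul_zero, zero_mul]
  have h1 : Function.update id x y x = Function.update id x y y := by
    rw [Function.update_self, Function.update_of_ne hne.symm, id]
  rcases lt_or_gt_of_ne (hρ.ne hne) with h | h
  · exact Finset.prod_eq_zero (i := (x, y)) (by simp [h]) (h0 x y hxy h1)
  · exact Finset.prod_eq_zero (i := (y, x)) (by simp [h]) (h0 y x hxy.symm h1.symm)

/-- The span of the products of Laurent monomials with the `orderZeta ρ`. -/
def orderSpan (n : I → ℕ) : Submodule (Ground I) (RatFun n) :=
  Submodule.span (Ground I) {r | ∃ d ρ, Function.Injective ρ ∧ r = mono d * orderZeta ρ}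

theorem toRatFun_mul_mem_orderSpan (R : Laurent n) {r : RatFun n} (hr : r ∈ orderSpan n) :
    toRatFun n R * r ∈ orderSpan n := by
  have h := Submodule.mul_mem_mul (toRatFun_mem_span R) hr
  rw [orderSpan, Submodule.span_mul_span] at h
  refine Submodule.span_mono ?_ h
  rintro _ ⟨_, ⟨d, rfl⟩, _, ⟨d', ρ, hρ, rfl⟩, rfl⟩
  exact ⟨d + d', ρ, hρ, by rw [← mono_mul_mono, mul_assoc]⟩

theorem algebraMap_mul_mem_orderSpan (p : MvPolynomial (Var n) (Ground I)) {r : RatFun n}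
    (hr : r ∈ orderSpan n) : algebraMap _ (RatFun n) p * r ∈ orderSpan n := by
  have h := toRatFun_mul_mem_orderSpan (unshift 0 p) hr
  rwa [toRatFun_unshift, pow_zero, inv_one, mul_one] at h

theorem algebraMap_div_vandermonde_mem_orderSpan {g : MvPolynomial (Var n) (Ground I)}
    (hg : g ∈ numIdeal n) :
    algebraMap _ (RatFun n) g * (algebraMap _ (RatFun n) (vandermonde n))⁻¹ ∈ orderSpan n := by
  unfold numIdeal at hg
  induction hg using Submodule.span_induction with
  | mem g hg =>
    obtain ⟨ρ, hρ, rfl⟩ := hg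
    obtain ⟨c, hc⟩ := vandermonde_dvd_prod_den hρ
    have hv := algebraMap_vandermonde_ne_zero n
    have h : algebraMap _ (RatFun n) (orderNum ρ) * (algebraMap _ (RatFun n) (vandermonde n))⁻¹ =
        algebraMap _ (RatFun n) c * orderZeta ρ := by
      rw [← orderZeta_mul_den, hc, map_mul]
      field_simp
    rw [h]
    refine algebraMap_mul_mem_orderSpan c (Submodule.subset_span ⟨0, ρ, hρ, ?_⟩)
    simp [mono]
  | zero => simp
  | add x y _ _ hx hy =>
    rw [map_add, add_mul]
    exact Submodule.add_mem _ hx hy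
  | smul a x _ hx =>
    rw [smul_eq_mul, map_mul, mul_assoc]
    exact algebraMap_mul_mem_orderSpan a hx

theorem toRatFun_mem_orderSpan {R : Laurent n} (h : Wheel R) : toRatFun n R ∈ orderSpan n := by
  obtain ⟨M, hM⟩ := exists_shift R
  obtain ⟨M', hM'⟩ := exists_pow_mul_mem_numIdeal (h.polyWheel hM)
  have h1 := toRatFun_mul_mem_orderSpan (unshift (M' + M) 1)
    (algebraMap_div_vandermonde_mem_orderSpan hM')
  have hv := algebraMap_vandermonde_ne_zero n
  have hz := prod_z_ne_zero (n := n)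
  have hX : algebraMap _ (RatFun n) (∏ x : Var n, X x : MvPolynomial (Var n) (Ground I)) =
      ∏ x, z x := map_prod _ _ _
  rw [toRatFun_unshift, map_one, one_mul, map_mul, map_mul, map_pow, hX, ← toRatFun_mul_pow hM] at h1
  convert h1 using 1
  rw [pow_add]
  field_simp

theorem inDegree_sym_mem {r : RatFun n} (hr : r ∈ orderSpan n) :
    inDegree I n (sym n r) ∈ sphericalAlgebra I := by
  have h : orderSpan n ≤ (sphericalAlgebra I).comap ((inDegree I n).comp (sym n)) := by
    refine Submodule.span_le.2 ?_
    rintro _ ⟨d, ρ, hρ, rfl⟩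
    exact inDegree_sym_mono_mul_orderZeta_mem _ n rfl d ρ hρ
  exact h hr

theorem inDegree_toRatFun_mem {R : Laurent n} (hR : R ∈ shufflePiece n) :
    inDegree I n (toRatFun n R) ∈ sphericalAlgebra I := by
  have h := inDegree_sym_mem (toRatFun_mem_orderSpan hR.2)
  rw [sym_apply, Finset.sum_congr rfl fun π _ => (isSymmetric_iff R).1 hR.1 π, Finset.sum_const,
    ← Nat.cast_smul_eq_nsmul (Ground I), map_smul] at h
  have hc : ((Finset.univ : Finset (∀ i, Equiv.Perm (Fin (n i)))).card : Ground I) ≠ 0 :=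
    Nat.cast_ne_zero.2 Fintype.card_ne_zero
  rw [← inv_smul_smul₀ hc (inDegree I n (toRatFun n R))]
  exact Submodule.smul_mem _ _ h

theorem shuffleAlgebra_le_sphericalAlgebra : shuffleAlgebra I ≤ sphericalAlgebra I := by
  classical
  intro F hF
  rw [← DirectSum.sum_support_of F]
  refine Submodule.sum_mem _ fun n _ => ?_
  obtain ⟨R, hR, h⟩ := hF n
  rw [← h]
  exact inDegree_toRatFun_mem hR

end OrderSpan

section WheelPoints

variable {I : Type u} [Quiver.{v} I] {n : I → ℕ}

theorem C_mul_X_inj {V F : Type*} [Field F] {c d : F} {a b : V} (hc : c ≠ 0)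
    (h : (C c * X a : MvPolynomial V F) = C d * X b) : a = b ∧ c = d := by
  have h1 := congrArg (MvPolynomial.eval fun _ => (1 : F)) h
  simp only [map_mul, MvPolynomial.eval_C, MvPolynomial.eval_X, mul_one] at h1
  subst h1
  refine ⟨?_, rfl⟩
  have hC : (C c : MvPolynomial V F) ≠ 0 := by simpa using hc
  exact MvPolynomial.X_injective (mul_left_cancel₀ hC h)

variable [DecidableEq I]

theorem wheel_point_injective {b m w : Var n} (hwb : w ≠ b) (hmb : m ≠ b) (a : Arr b.1 m.1) :
    Function.Injective (Function.update (Function.update X w (C (q I) * X b)) m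
      (C (coef a) * X b) : Var n → MvPolynomial (Var n) (Ground I)) := by
  set c : Var n → Ground I := Function.update (Function.update 1 w (q I)) m (coef a) with hc
  set g : Var n → Var n := Function.update (Function.update id w b) m b with hg
  have h : (Function.update (Function.update X w (C (q I) * X b)) m (C (coef a) * X b) :
      Var n → MvPolynomial (Var n) (Ground I)) = fun x => C (c x) * X (g x) := by
    funext x
    by_cases hxm : x = m
    · subst hxm; simp [hc, hg]
    · by_cases hxw : x = w
      · subst hxw; simp [hc, hg, hxm]
      · simp [hc, hg, hxm, hxw]
  have hc0 : ∀ x, c x ≠ 0 := by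
    intro x
    by_cases hxm : x = m
    · subst hxm; simp [hc, coef_ne_zero]
    · by_cases hxw : x = w
      · subst hxw; simp [hc, hxm, q_ne_zero]
      · simp [hc, hxm, hxw]
  rw [h]
  have hcases : ∀ x, x = m ∧ c x = coef a ∨ x = w ∧ c x = q I ∨ g x = x ∧ c x = 1 := by
    intro x
    by_cases hxm : x = m
    · subst hxm; simp [hc]
    · by_cases hxw : x = w
      · subst hxw; simp [hc, hxm]
      · simp [hc, hg, hxm, hxw]
  intro x y hxy
  obtain ⟨h1, h2⟩ := C_mul_X_inj (hc0 x) hxy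
  rcases hcases x with ⟨hx, hx'⟩ | ⟨hx, hx'⟩ | ⟨hx, hx'⟩ <;>
    rcases hcases y with ⟨hy, hy'⟩ | ⟨hy, hy'⟩ | ⟨hy, hy'⟩ <;> rw [hx', hy'] at h2
  · rw [hx, hy]
  · exact absurd h2 (coef_ne_q a)
  · exact absurd h2 (coef_ne_one a)
  · exact absurd h2.symm (coef_ne_q a)
  · rw [hx, hy]
  · exact absurd h2 q_ne_one
  · exact absurd h2.symm (coef_ne_one a)
  · exact absurd h2.symm q_ne_one
  · rw [← hx, ← hy, h1]

theorem PolyWheel.rename_permVar {p : MvPolynomial (Var n) (Ground I)} (h : PolyWheel p)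
    (π : ∀ i, Equiv.Perm (Fin (n i))) : PolyWheel (MvPolynomial.rename (permVar π) p) := by
  intro b m w hw hwb hmb hmw a
  obtain ⟨b, rfl⟩ := (Equiv.sigmaCongrRight π).surjective b
  obtain ⟨m, rfl⟩ := (Equiv.sigmaCongrRight π).surjective m
  obtain ⟨w, rfl⟩ := (Equiv.sigmaCongrRight π).surjective w
  rw [MvPolynomial.aeval_rename]
  refine h.aeval_eq_zero (b := b) (m := m) (w := w) hw (ne_of_apply_ne _ hwb)
    (ne_of_apply_ne _ hmb) (ne_of_apply_ne _ hmw) a _ ?_ ?_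
  · change Function.update (Function.update X _ _) _ _ (Equiv.sigmaCongrRight π w) =
      q I • Function.update (Function.update X _ _) _ _ (Equiv.sigmaCongrRight π b)
    rw [Function.update_of_ne hmw.symm, Function.update_self, Function.update_of_ne hmb.symm,
      Function.update_of_ne hwb.symm, MvPolynomial.smul_eq_C_mul]
  · change Function.update (Function.update X _ _) _ _ (Equiv.sigmaCongrRight π m) =
      coef a • Function.update (Function.update X _ _) _ _ (Equiv.sigmaCongrRight π b)
    rw [Function.update_self, Function.update_of_ne hmb.symm,
      Function.update_of_ne hwb.symm, MvPolynomial.smul_eq_C_mul]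

theorem PolyWheel.mul_right {p : MvPolynomial (Var n) (Ground I)} (h : PolyWheel p)
    (g : MvPolynomial (Var n) (Ground I)) : PolyWheel (p * g) := fun b m w hw hwb hmb hmw a => by
  rw [map_mul, h b m w hw hwb hmb hmw a, zero_mul]

theorem PolyWheel.sum {ι : Type*} {s : Finset ι} {p : ι → MvPolynomial (Var n) (Ground I)}
    (h : ∀ i ∈ s, PolyWheel (p i)) : PolyWheel (∑ i ∈ s, p i) :=
  fun b m w hw hwb hmb hmw a => by
    rw [map_sum]
    exact Finset.sum_eq_zero fun i hi => h i hi b m w hw hwb hmb hmw a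

theorem aeval_num_eq_zero_of_coef [∀ i j : I, Fintype (i ⟶ j)] {x y : Var n}
    (f : Var n → MvPolynomial (Var n) (Ground I))
    (a : Arr x.1 y.1) (h : f y = C (coef a) * f x) : aeval f (num x y) = 0 := by
  rw [num, map_mul, map_prod, Finset.prod_eq_zero (Finset.mem_univ a), mul_zero]
  simp [h]

theorem aeval_num_eq_zero_of_q [∀ i j : I, Fintype (i ⟶ j)] {x y : Var n}
    (f : Var n → MvPolynomial (Var n) (Ground I))
    (hxy : x.1 = y.1) (h : f x = C (q I) * f y) : aeval f (num x y) = 0 := by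
  rw [num, if_pos hxy, map_mul]
  simp [h]

theorem aeval_num_eq_zero_of_swap [∀ i j : I, Fintype (i ⟶ j)] {b m w : Var n}
    (f : Var n → MvPolynomial (Var n) (Ground I)) (hw : w.1 = b.1) (a : Arr b.1 m.1)
    (hfw : f w = C (q I) * f b) (hfm : f m = C (coef a) * f b) : aeval f (num m w) = 0 := by
  obtain ⟨i, w⟩ := w
  obtain ⟨j, b⟩ := b
  obtain rfl : i = j := hw
  refine aeval_num_eq_zero_of_coef f a.swap ?_
  rw [hfw, hfm, ← coef_mul_coef_swap a, map_mul, mul_comm (C (coef a)), mul_assoc]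

variable [Fintype I]

theorem aeval_vandermonde_ne_zero {f : Var n → MvPolynomial (Var n) (Ground I)}
    (hf : Function.Injective f) : aeval f (vandermonde n) ≠ 0 := by
  rw [vandermonde, map_prod]
  refine Finset.prod_ne_zero_iff.2 fun p hp => ?_
  simp only [Finset.mem_filter, Finset.mem_univ, true_and] at hp
  rw [map_sub, MvPolynomial.aeval_X, MvPolynomial.aeval_X, sub_ne_zero]
  exact hf.ne (var_ne_of_lt hp.2)

theorem PolyWheel.of_vandermonde_mul {p : MvPolynomial (Var n) (Ground I)}
    (h : PolyWheel (vandermonde n * p)) : PolyWheel p := by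
  intro b m w hw hwb hmb hmw a
  have h1 := h b m w hw hwb hmb hmw a
  rw [map_mul] at h1
  exact (mul_eq_zero.1 h1).resolve_left
    (aeval_vandermonde_ne_zero (wheel_point_injective hwb hmb a))

variable [∀ i j : I, Fintype (i ⟶ j)]

/-- The numerator of the kernel. -/
def kernelNum (n n' : I → ℕ) : MvPolynomial (Var (n + n')) (Ground I) :=
  ∏ x : Var n, ∏ y : Var n', num (leftVar n n' x) (rightVar n n' y)

theorem aeval_kernelNum_eq_zero {n n' : I → ℕ}
    {f : Var (n + n') → MvPolynomial (Var (n + n')) (Ground I)} {x : Var n} {y : Var n'}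
    (h : aeval f (num (leftVar n n' x) (rightVar n n' y)) = 0) :
    aeval f (kernelNum n n') = 0 := by
  rw [kernelNum, map_prod]
  refine Finset.prod_eq_zero (Finset.mem_univ x) ?_
  rw [map_prod]
  exact Finset.prod_eq_zero (Finset.mem_univ y) h

theorem polyWheel_mul_kernelNum {n n' : I → ℕ} {p : MvPolynomial (Var n) (Ground I)}
    {p' : MvPolynomial (Var n') (Ground I)} (hp : PolyWheel p) (hp' : PolyWheel p') :
    PolyWheel (MvPolynomial.rename (leftVar n n') p * MvPolynomial.rename (rightVar n n') p' *
      kernelNum n n') := by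
  intro b m w hw hwb hmb hmw a
  set f : Var (n + n') → MvPolynomial (Var (n + n')) (Ground I) :=
    Function.update (Function.update X w (C (q I) * X b)) m (C (coef a) * X b) with hf
  have hb : f b = X b := by
    rw [hf, Function.update_of_ne hmb.symm, Function.update_of_ne hwb.symm]
  have hfw : f w = C (q I) * f b := by
    rw [hb, hf, Function.update_of_ne hmw.symm, Function.update_self]
  have hfm : f m = C (coef a) * f b := by
    rw [hb, hf, Function.update_self]
  clear_value f
  rw [map_mul, map_mul, MvPolynomial.aeval_rename, MvPolynomial.aeval_rename]
  rcases var_cases b with ⟨b, rfl⟩ | ⟨b, rfl⟩ <;> rcases var_cases m with ⟨m, rfl⟩ | ⟨m, rfl⟩ <;>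
    rcases var_cases w with ⟨w, rfl⟩ | ⟨w, rfl⟩
  · rw [hp.aeval_eq_zero (b := b) (m := m) (w := w) hw (ne_of_apply_ne _ hwb)
      (ne_of_apply_ne _ hmb) (ne_of_apply_ne _ hmw) a _
      (hfw.trans (MvPolynomial.smul_eq_C_mul _ _).symm)
      (hfm.trans (MvPolynomial.smul_eq_C_mul _ _).symm), zero_mul, zero_mul]
  · rw [aeval_kernelNum_eq_zero (x := m) (y := w), mul_zero]
    exact aeval_num_eq_zero_of_swap f hw a hfw hfm
  · rw [aeval_kernelNum_eq_zero (aeval_num_eq_zero_of_coef f a hfm), mul_zero]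
  · rw [aeval_kernelNum_eq_zero (aeval_num_eq_zero_of_coef f a hfm), mul_zero]
  · rw [aeval_kernelNum_eq_zero (aeval_num_eq_zero_of_q f hw hfw), mul_zero]
  · rw [aeval_kernelNum_eq_zero (x := m) (y := w), mul_zero]
    exact aeval_num_eq_zero_of_swap f hw a hfw hfm
  · rw [aeval_kernelNum_eq_zero (aeval_num_eq_zero_of_q f hw hfw), mul_zero]
  · rw [hp'.aeval_eq_zero (b := b) (m := m) (w := w) hw (ne_of_apply_ne _ hwb)
      (ne_of_apply_ne _ hmb) (ne_of_apply_ne _ hmw) a _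
      (hfw.trans (MvPolynomial.smul_eq_C_mul _ _).symm)
      (hfm.trans (MvPolynomial.smul_eq_C_mul _ _).symm), mul_zero, zero_mul]

end WheelPoints

section Transposition

variable {I : Type u} [DecidableEq I] {n : I → ℕ}

theorem exists_permVar_swap {x y : Var n} (h : x.1 = y.1) :
    ∃ π : ∀ i, Equiv.Perm (Fin (n i)), ∀ u, permVar π u = Equiv.swap x y u := by
  obtain ⟨i, a⟩ := x
  obtain ⟨j, b⟩ := y
  obtain rfl : i = j := h
  refine ⟨Function.update 1 i (Equiv.swap a b), fun u => ?_⟩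
  obtain ⟨j, c⟩ := u
  change (⟨j, Function.update (1 : ∀ i, Equiv.Perm (Fin (n i))) i (Equiv.swap a b) j c⟩ : Var n) = _
  by_cases hj : j = i
  · subst hj
    rw [Function.update_self, Equiv.swap_apply_def, Equiv.swap_apply_def]
    by_cases h1 : c = a
    · simp [h1]
    · by_cases h2 : c = b
      · subst h2
        simp [h1]
      · simp [h1, h2]
  · rw [Function.update_of_ne hj, Equiv.swap_apply_of_ne_of_ne]
    · rfl
    · intro e
      exact hj (congrArg Sigma.fst e)
    · intro e
      exact hj (congrArg Sigma.fst e)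

theorem collapse_comp_permVar {x y : Var n} (hne : x ≠ y) {π : ∀ i, Equiv.Perm (Fin (n i))}
    (hπ : ∀ u, permVar π u = Equiv.swap x y u) :
    (Function.update id x y ∘ permVar π : Var n → Var n) = Function.update id x y := by
  funext u
  rw [Function.comp_apply, hπ]
  by_cases hux : u = x
  · rw [hux, Equiv.swap_apply_left, Function.update_self, Function.update_of_ne hne.symm, id]
  · by_cases huy : u = y
    · rw [huy, Equiv.swap_apply_right, Function.update_self, Function.update_of_ne hne.symm, id]
    · rw [Equiv.swap_apply_of_ne_of_ne hux huy]

end Transposition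

section SymmetrizeVandermonde

variable {I : Type u} [Quiver.{v} I] [Fintype I] [DecidableEq I] {n : I → ℕ}

theorem vandermonde_dvd_rename (π : ∀ i, Equiv.Perm (Fin (n i))) :
    vandermonde n ∣ MvPolynomial.rename (permVar π) (vandermonde n) := by
  refine vandermonde_dvd fun x y hxy hlt => ?_
  obtain ⟨x, rfl⟩ := (Equiv.sigmaCongrRight π).surjective x
  obtain ⟨y, rfl⟩ := (Equiv.sigmaCongrRight π).surjective y
  have hne := var_ne_of_lt hlt
  have hxy' : x.1 = y.1 := hxy
  have h0 : ∀ a b : Var n, Function.update id (Equiv.sigmaCongrRight π x)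
      (Equiv.sigmaCongrRight π y) (Equiv.sigmaCongrRight π a) =
      Function.update id (Equiv.sigmaCongrRight π x)
      (Equiv.sigmaCongrRight π y) (Equiv.sigmaCongrRight π b) →
      MvPolynomial.rename (Function.update id (Equiv.sigmaCongrRight π x)
      (Equiv.sigmaCongrRight π y)) (MvPolynomial.rename (permVar π)
        (X a - X b : MvPolynomial (Var n) (Ground I))) = 0 := by
    intro a b h
    rw [map_sub, map_sub, MvPolynomial.rename_X, MvPolynomial.rename_X, MvPolynomial.rename_X,
      MvPolynomial.rename_X, sub_eq_zero]
    exact congrArg X h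
  have h1 : Function.update id (Equiv.sigmaCongrRight π x)
      (Equiv.sigmaCongrRight π y) (Equiv.sigmaCongrRight π x) =
      Function.update id (Equiv.sigmaCongrRight π x)
      (Equiv.sigmaCongrRight π y) (Equiv.sigmaCongrRight π y) := by
    rw [Function.update_self, Function.update_of_ne hne.symm, id]
  rw [vandermonde, map_prod, map_prod]
  have hval : (x.2 : ℕ) ≠ y.2 := by
    intro e
    obtain ⟨i, a⟩ := x
    obtain ⟨j, b⟩ := y
    obtain rfl : i = j := hxy'
    exact hne (congrArg _ (congrArg _ (Fin.ext e)))
  rcases lt_or_gt_of_ne hval with h | h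
  · exact Finset.prod_eq_zero (i := (x, y)) (by simp [h, hxy']) (h0 x y h1)
  · exact Finset.prod_eq_zero (i := (y, x)) (by simp [h, hxy']) (h0 y x h1.symm)

theorem rename_vandermonde_dvd (π : ∀ i, Equiv.Perm (Fin (n i))) :
    MvPolynomial.rename (permVar π) (vandermonde n) ∣ vandermonde n := by
  obtain ⟨c, hc⟩ := vandermonde_dvd_rename (n := n) (π⁻¹)
  refine ⟨MvPolynomial.rename (permVar π) c, ?_⟩
  rw [← map_mul, ← hc, MvPolynomial.rename_rename]
  have h : (permVar π ∘ permVar π⁻¹ : Var n → Var n) = id :=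
    funext (Equiv.sigmaCongrRight π).apply_symm_apply
  rw [h, MvPolynomial.rename_id_apply]

theorem rename_collapse_eq_neg_one {x y : Var n} (hxy : x.1 = y.1) (hlt : (x.2 : ℕ) < y.2)
    {π : ∀ i, Equiv.Perm (Fin (n i))} (hπ : ∀ u, permVar π u = Equiv.swap x y u)
    {c : MvPolynomial (Var n) (Ground I)}
    (hc : MvPolynomial.rename (permVar π) (vandermonde n) = vandermonde n * c) :
    MvPolynomial.rename (Function.update id x y) c = -1 := by
  have hmem : (x, y) ∈ (Finset.univ : Finset (Var n × Var n)).filter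
      fun p => p.1.1 = p.2.1 ∧ (p.1.2 : ℕ) < p.2.2 := by simp [hxy, hlt]
  set D : MvPolynomial (Var n) (Ground I) := ∏ p ∈ ((Finset.univ : Finset (Var n × Var n)).filter
      fun p => p.1.1 = p.2.1 ∧ (p.1.2 : ℕ) < p.2.2).erase (x, y), (X p.1 - X p.2) with hD
  have hv : vandermonde n = (X x - X y) * D := (Finset.mul_prod_erase _ _ hmem).symm
  have hne := var_ne_of_lt hlt
  rw [hv, map_mul, map_sub, MvPolynomial.rename_X, MvPolynomial.rename_X, hπ, hπ,
    Equiv.swap_apply_left, Equiv.swap_apply_right, mul_assoc] at hc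
  have h1 : -MvPolynomial.rename (permVar π) D = D * c := by
    refine mul_left_cancel₀ (WheelGraph.X_sub_X_ne_zero (F := Ground I) hne) ?_
    rw [← hc]
    ring
  have h2 := congrArg (MvPolynomial.rename (Function.update id x y)) h1
  rw [map_neg, MvPolynomial.rename_rename, collapse_comp_permVar hne hπ, map_mul] at h2
  have hD0 : MvPolynomial.rename (Function.update id x y) D ≠ 0 := by
    rw [hD, map_prod]
    refine Finset.prod_ne_zero_iff.2 fun p hp => WheelGraph.rename_X_sub_X_ne_zero ?_
    obtain ⟨hp1, hp2⟩ := Finset.mem_erase.1 hp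
    simp only [Finset.mem_filter, Finset.mem_univ, true_and] at hp2
    exact collapse_ne hlt hp2.2 hp1.symm
  refine mul_left_cancel₀ hD0 ?_
  rw [← h2, mul_neg, mul_one]

/-- A symmetric rational function whose only denominators are monomials and the Vandermonde
product is a Laurent polynomial. -/
theorem vandermonde_dvd_of_symmetric {r : RatFun n} (hr : ∀ π, rename (permVar π) r = r) {K : ℕ}
    {g : MvPolynomial (Var n) (Ground I)}
    (h : r * algebraMap _ (RatFun n) (vandermonde n * (∏ x, X x) ^ K) = algebraMap _ _ g) :
    vandermonde n ∣ g := by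
  refine vandermonde_dvd fun x y hxy hlt => ?_
  obtain ⟨π, hπ⟩ := exists_permVar_swap hxy
  obtain ⟨c, hc⟩ := vandermonde_dvd_rename π
  have hP : MvPolynomial.rename (permVar π) (∏ x, X x : MvPolynomial (Var n) (Ground I)) =
      ∏ x, X x := by
    rw [map_prod]
    exact Fintype.prod_equiv (Equiv.sigmaCongrRight π) _ _ fun x => MvPolynomial.rename_X _ _
  have h1 : MvPolynomial.rename (permVar π) g = g * c := by
    apply algebraMap_ratFun_injective
    rw [← rename_algebraMap, ← h, map_mul (rename _), hr, rename_algebraMap, map_mul, map_pow, hP,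
      hc, map_mul (algebraMap _ _) g c, ← h]
    simp only [map_mul]
    ring
  have h2 := congrArg (MvPolynomial.rename (Function.update id x y)) h1
  rw [MvPolynomial.rename_rename, collapse_comp_permVar (var_ne_of_lt hlt) hπ, map_mul,
    rename_collapse_eq_neg_one hxy hlt hπ hc, mul_neg, mul_one] at h2
  exact CharZero.eq_neg_self_iff.1 h2

theorem sym_mem_of_polyWheel {r : RatFun n} {K : ℕ} {g : MvPolynomial (Var n) (Ground I)}
    (hg : PolyWheel g)
    (h : r * algebraMap _ (RatFun n) (vandermonde n * (∏ x, X x) ^ K) = algebraMap _ _ g) :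
    sym n r ∈ (shufflePiece n).map (toRatFun n) := by
  have hP : ∀ π : ∀ i, Equiv.Perm (Fin (n i)), MvPolynomial.rename (permVar π)
      (∏ x, X x : MvPolynomial (Var n) (Ground I)) = ∏ x, X x := by
    intro π
    rw [map_prod]
    exact Fintype.prod_equiv (Equiv.sigmaCongrRight π) _ _ fun x => MvPolynomial.rename_X _ _
  choose c hc using fun π => rename_vandermonde_dvd (n := n) π
  have hsum : sym n r * algebraMap _ (RatFun n) (vandermonde n * (∏ x, X x) ^ K) =
      algebraMap _ _ (∑ π : (∀ i, Equiv.Perm (Fin (n i))),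
        MvPolynomial.rename (permVar π) g * c π) := by
    rw [sym_apply, Finset.sum_mul, map_sum]
    refine Finset.sum_congr rfl fun π _ => ?_
    have h1 := congrArg (rename (permVar π)) h
    rw [map_mul, rename_algebraMap, rename_algebraMap, map_mul, map_pow, hP] at h1
    rw [map_mul _ (MvPolynomial.rename _ g), ← h1]
    conv_lhs => rw [hc π]
    simp only [map_mul]
    ring
  have hwheel : PolyWheel (∑ π : (∀ i, Equiv.Perm (Fin (n i))),
        MvPolynomial.rename (permVar π) g * c π) :=
    PolyWheel.sum fun π _ => (hg.rename_permVar π).mul_right _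
  obtain ⟨p, hp⟩ := vandermonde_dvd_of_symmetric (fun π => rename_sym π r) hsum
  rw [hp] at hwheel hsum
  have hX : algebraMap _ (RatFun n) (∏ x : Var n, X x : MvPolynomial (Var n) (Ground I)) =
      ∏ x, z x := map_prod _ _ _
  have hR : toRatFun n (unshift K p) = sym n r := by
    have hv := algebraMap_vandermonde_ne_zero n
    have hz := prod_z_ne_zero (n := n)
    rw [map_mul, map_mul, map_pow, hX] at hsum
    rw [toRatFun_unshift, ← div_eq_mul_inv, div_eq_iff (pow_ne_zero _ hz)]
    refine mul_left_cancel₀ hv ?_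
    rw [← hsum]
    ring
  refine ⟨unshift K p, ⟨(isSymmetric_iff _).2 fun π => ?_,
    hwheel.of_vandermonde_mul.wheel K⟩, hR⟩
  rw [hR, rename_sym]

end SymmetrizeVandermonde

section Closure

variable {I : Type u} [Quiver.{v} I] [Fintype I] [DecidableEq I]

theorem inDegree_mem_shuffleAlgebra {n : I → ℕ} {r : RatFun n}
    (hr : r ∈ (shufflePiece n).map (toRatFun n)) : inDegree I n r ∈ shuffleAlgebra I := by
  intro m
  by_cases h : n = m
  · subst h
    rw [inDegree, DirectSum.lof_eq_of, DirectSum.of_eq_same]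
    exact hr
  · rw [inDegree, DirectSum.lof_eq_of, DirectSum.of_eq_of_ne _ _ _ (Ne.symm h)]
    exact Submodule.zero_mem _

theorem one_mem_shuffleAlgebra : one I ∈ shuffleAlgebra I := by
  refine inDegree_mem_shuffleAlgebra ⟨AddMonoidAlgebra.single 0 1,
    ⟨fun _ d => congrArg _ (funext fun x => x.2.elim0), fun _ _ _ a => a.elim0,
      fun _ _ _ a => a.elim0⟩, ?_⟩
  rw [toRatFun_single, one_smul]
  simp [mono]

variable [∀ i j : I, Fintype (i ⟶ j)]

/-- The denominator of the kernel. -/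
def kernelDen (n n' : I → ℕ) : MvPolynomial (Var (n + n')) (Ground I) :=
  ∏ x : Var n, ∏ y : Var n', den (leftVar n n' x) (rightVar n n' y)

theorem kernel_mul_kernelDen (n n' : I → ℕ) :
    kernel n n' * algebraMap _ (RatFun (n + n')) (kernelDen n n') =
      algebraMap _ (RatFun (n + n')) (kernelNum n n') := by
  simp only [kernel, kernelDen, kernelNum, map_prod, ← Finset.prod_mul_distrib]
  exact Finset.prod_congr rfl fun x _ => Finset.prod_congr rfl fun y _ =>
    zeta_mul_den (leftVar_ne_rightVar x y)

theorem kernelDen_dvd (n n' : I → ℕ) :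
    ∃ k, kernelDen n n' ∣ vandermonde (n + n') * (∏ x, X x) ^ k := by
  refine ⟨∑ x : Var n, ∑ y : Var n', Fintype.card (Arr x.1 y.1), ?_⟩
  simp only [kernelDen, den, Finset.prod_mul_distrib]
  refine mul_dvd_mul ?_ ?_
  · rw [← Fintype.prod_prod_type', ← Finset.prod_filter]
    refine dvd_trans (Finset.prod_dvd_prod_of_dvd _
      (fun p : Var n × Var n' => X (leftVar n n' p.1) - X (rightVar n n' p.2)) fun p _ => ?_) ?_
    · refine ⟨C (-(q I)⁻¹), ?_⟩
      have : (C (q I) * C (q I)⁻¹ : MvPolynomial (Var (n + n')) (Ground I)) = 1 := by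
        rw [← map_mul, mul_inv_cancel₀ (q_ne_zero I), map_one]
      rw [map_neg]
      linear_combination (X (rightVar n n' p.2) - X (leftVar n n' p.1)) * this
    · have h := Finset.prod_map (Finset.univ.filter
        fun p : Var n × Var n' => (leftVar n n' p.1).1 = (rightVar n n' p.2).1)
        ((leftVar n n').prodMap (rightVar n n'))
        fun p => (X p.1 - X p.2 : MvPolynomial (Var (n + n')) (Ground I))
      refine dvd_trans (dvd_of_eq h.symm) (Finset.prod_dvd_prod_of_subset _ _ _ ?_)
      intro p hp
      obtain ⟨⟨⟨i, a⟩, ⟨j, b⟩⟩, hp', rfl⟩ := Finset.mem_map.1 hp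
      refine Finset.mem_filter.2 ⟨Finset.mem_univ _, (Finset.mem_filter.1 hp').2, ?_⟩
      obtain rfl : i = j := (Finset.mem_filter.1 hp').2
      change (a : ℕ) < n i + b
      have := a.2
      omega
  · rw [← Finset.prod_pow_eq_pow_sum]
    refine Finset.prod_dvd_prod_of_dvd _ _ fun x _ => ?_
    rw [← Finset.prod_pow_eq_pow_sum]
    refine Finset.prod_dvd_prod_of_dvd _ _ fun y _ => pow_dvd_pow_of_dvd ?_ _
    exact Finset.dvd_prod_of_mem _ (Finset.mem_univ _)

theorem shuffle_mem {n n' : I → ℕ} {R : Laurent n} {R' : Laurent n'} (hR : Wheel R)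
    (hR' : Wheel R') :
    shuffle n n' (toRatFun n R) (toRatFun n' R') ∈
      (shufflePiece (n + n')).map (toRatFun (n + n')) := by
  rw [shuffle_apply]
  refine Submodule.smul_mem _ _ ?_
  obtain ⟨M, hM⟩ := exists_shift R
  obtain ⟨M', hM'⟩ := exists_shift R'
  obtain ⟨k, E, hE⟩ := kernelDen_dvd n n'
  set L : MvPolynomial (Var (n + n')) (Ground I) := ∏ x, X (leftVar n n' x) with hL
  set L' : MvPolynomial (Var (n + n')) (Ground I) := ∏ x, X (rightVar n n' x) with hL'
  have h1 : rename (leftVar n n') (toRatFun n R) * algebraMap _ (RatFun (n + n')) (L ^ M) =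
      algebraMap _ (RatFun (n + n')) (MvPolynomial.rename (leftVar n n') (shiftPoly M R)) := by
    rw [← rename_algebraMap, ← toRatFun_mul_pow hM, map_mul (rename _), map_pow, map_pow,
      map_prod (rename _), hL, map_prod]
    simp only [rename_z]
    rfl
  have h1' : rename (rightVar n n') (toRatFun n' R') * algebraMap _ (RatFun (n + n')) (L' ^ M') =
      algebraMap _ (RatFun (n + n')) (MvPolynomial.rename (rightVar n n') (shiftPoly M' R')) := by
    rw [← rename_algebraMap, ← toRatFun_mul_pow hM', map_mul (rename _), map_pow, map_pow,
      map_prod (rename _), hL', map_prod]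
    simp only [rename_z]
    rfl
  refine sym_mem_of_polyWheel (K := k + M + M') ((polyWheel_mul_kernelNum (hR.polyWheel hM)
    (hR'.polyWheel hM')).mul_right (E * L' ^ M * L ^ M')) ?_
  have hprod : (∏ x, X x : MvPolynomial (Var (n + n')) (Ground I)) = L * L' := prod_var_add _
  have h2 : vandermonde (n + n') * (∏ x, X x) ^ (k + M + M') =
      L ^ M * L' ^ M' * kernelDen n n' * (E * L' ^ M * L ^ M') := by
    rw [pow_add, pow_add, ← mul_assoc, ← mul_assoc, hE, hprod]
    ring
  rw [h2]
  simp only [map_mul]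
  rw [← h1, ← h1', ← kernel_mul_kernelDen]
  ring

theorem mul_mem_shuffleAlgebra {F G : Total I} (hF : F ∈ shuffleAlgebra I)
    (hG : G ∈ shuffleAlgebra I) : mul I F G ∈ shuffleAlgebra I := by
  classical
  rw [← DirectSum.sum_support_of F, map_sum, LinearMap.sum_apply]
  refine Submodule.sum_mem _ fun n _ => ?_
  rw [← DirectSum.sum_support_of G, map_sum]
  refine Submodule.sum_mem _ fun m _ => ?_
  obtain ⟨R, hR, h⟩ := hF n
  obtain ⟨R', hR', h'⟩ := hG m
  rw [← h, ← h']
  change mul I (inDegree I n _) (inDegree I m _) ∈ _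
  rw [mul_inDegree]
  exact inDegree_mem_shuffleAlgebra (shuffle_mem hR.2 hR'.2)

theorem sphericalAlgebra_le_shuffleAlgebra : sphericalAlgebra I ≤ shuffleAlgebra I := by
  refine sInf_le ⟨one_mem_shuffleAlgebra, ?_, fun F hF G hG => mul_mem_shuffleAlgebra hF hG⟩
  rintro _ ⟨i, R, hR, rfl⟩
  exact inDegree_mem_shuffleAlgebra ⟨R, hR, rfl⟩

end Closure

end

end QuiverShuffle

theorem theorem2p7 (I : Type*) [Quiver I] [Fintype I] [DecidableEq I]
    [∀ i j : I, Fintype (i ⟶ j)] :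
    QuiverShuffle.sphericalAlgebra I = QuiverShuffle.shuffleAlgebra I := by
  exact le_antisymm QuiverShuffle.sphericalAlgebra_le_shuffleAlgebra
    QuiverShuffle.shuffleAlgebra_le_sphericalAlgebra
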